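/- Let $f_0,f_1,\dots,f_m$ be real-analytic vector fields on $\mathbb R^n$ and let $T>0$. For $u\in L^2([0,T],\mathbb R^m)$ let $x_u$ be the solution, if it exists on $[0,T]$, of $$\dot x=f_0(x)+\sum_{i=1}^m u_i f_i(x),\qquad x(0)=0,$$ understood in integral form. Let $\Omega\subset L^2([0,T],\mathbb R^m)$ be the set of controls $u$ for which $x_u$ exists on $[0,T]$, let $E:\Omega\to\mathbb R^n$, $E(u)=x_u(T)$, be the end-point mapping with Fréchet derivative $dE(u)$, and let $C(u)=\int_0^T\sum_{i=1}^m u_i(t)^2\,dt$. A control $u\in\Omega$ is *minimizing* if $C(u)\le C(v)$ for all $v\in\Omega$ with $E(v)=E(u)$. It is *abnormal* if $dE(u)$ is not surjective, and it has *corank 1* if $\operatorname{Im}dE(u)$ is a hyperplane of $\mathbb R^n$. Let $S(x)=\inf\{C(u): u\in\Omega,\ E(u)=x\}\in[0,+\infty]$ be the value function and $M_{\le r}(T)=\{x: S(x)\le r\}$. A point $P$ is a *normal point* if $P=E(u)$ for a minimizing control $u$ that has a Lagrange multiplier $(q,q^0)\in(\mathbb R^n)^*\times\mathbb R$ with $q^0\ne0$,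 that is, $q\circ dE(u)=-q^0\,dC(u)$. For $p_0\in T_0^*\mathbb R^n$ consider the normal Hamiltonian system $$\dot x=f_0(x)+\sum_{i=1}^m u_i f_i(x),\quad \dot p=-p\circ\Big(df_0(x)+\sum_{i=1}^m u_i\,df_i(x)\Big),\quad u_i=\langle p,f_i(x)\rangle,\quad x(0)=0,\ p(0)=p_0 .$$ Let $D\subset T_0^*\mathbb R^n$ be the set of $p_0$ for which the solution exists on $[0,T]$, let $\Phi:D\to L^2([0,T],\mathbb R^m)$ map $p_0$ to the control $u$ of this solution, and let $\exp=E\circ\Phi:D\to\mathbb R^n$. Let $A\in\mathbb R^n$ and $r>0$. Suppose that there is exactly one abnormal minimizing control $u$ of corank 1 with $E(u)=A$, and that $(H)$ every neighborhood $V$ of $A$ contains a normal point belonging to $M_{\le r}(T)$. Then $\exp:D\to\mathbb R^n$ is not proper: there is a compact set $K\subset\mathbb R^n$ such that $\exp^{-1}(K)$ is not compact. -/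

import Mathlib

open MeasureTheory Set Topology

noncomputable section

namespace AffineControl

/-- The state space `ℝⁿ`. -/
abbrev State (n : ℕ) : Type := EuclideanSpace ℝ (Fin n)

/-- Covectors at a point of `ℝⁿ`: the cotangent space `T*_x ℝⁿ`. -/
abbrev Covector (n : ℕ) : Type := StrongDual ℝ (State n)

/-- The Hilbert space `L²([0,T], ℝᵐ)` of controls. -/
abbrev Control (m : ℕ) (T : ℝ) : Type :=
  Lp (EuclideanSpace ℝ (Fin m)) 2 (volume.restrict (Icc (0 : ℝ) T))

section

variable {n m : ℕ} (f₀ : State n → State n) (f : Fin m → State n → State n) (T : ℝ)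

/-- `x` is on `[0,T]` the trajectory from the origin of
`x' = f₀(x) + ∑ i, u_i f_i(x)` associated to the control `u` (integral form). -/
def IsTrajectory (u : Control m T) (x : ℝ → State n) : Prop :=
  ContinuousOn x (Icc 0 T) ∧
    ∀ t ∈ Icc (0 : ℝ) T, x t = ∫ s in (0 : ℝ)..t, (f₀ (x s) + ∑ i, u s i • f i (x s))

/-- The set `Ω` of admissible controls: those whose trajectory exists on all of `[0,T]`. -/
def admissible : Set (Control m T) :=
  {u | ∃ x : ℝ → State n, IsTrajectory f₀ f T u x}

open Classical in
/-- The end-point mapping `E : u ↦ x_u(T)` on `Ω` (with the value `0` outside `Ω`; the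
trajectory of an admissible control is unique on `[0,T]` when the vector fields are smooth). -/
def endpoint (u : Control m T) : State n :=
  if h : ∃ x : ℝ → State n, IsTrajectory f₀ f T u x then h.choose T else 0

/-- The cost `C(u) = ∫₀ᵀ ∑ i, u_i(t)² dt`. -/
def cost (u : Control m T) : ℝ := ∫ t in (0 : ℝ)..T, ∑ i, (u t i) ^ 2

/-- The value function `S(x) = inf {C(u) | u ∈ Ω, E(u) = x}`, which is `∞` when `x` cannot be
reached from the origin in time `T`. -/
def value (x : State n) : ENNReal :=
  ⨅ u ∈ {u : Control m T | u ∈ admissible f₀ f T ∧ endpoint f₀ f T u = x},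
    ENNReal.ofReal (cost T u)

/-- The sublevel set `M_{≤ r}(T) = S⁻¹([0,r])` of the value function. -/
def sublevel (r : ℝ) : Set (State n) := {x | value f₀ f T x ≤ ENNReal.ofReal r}

/-- `u` is a minimizing control: it is admissible and has the least cost among the admissible
controls with the same end-point. -/
def IsMinimizing (u : Control m T) : Prop :=
  u ∈ admissible f₀ f T ∧
    ∀ v ∈ admissible f₀ f T, endpoint f₀ f T v = endpoint f₀ f T u → cost T u ≤ cost T v

/-- The Fréchet derivative `dE(u) : L²([0,T], ℝᵐ) → ℝⁿ` of the end-point mapping. -/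
def dEndpoint (u : Control m T) : Control m T →L[ℝ] State n := fderiv ℝ (endpoint f₀ f T) u

/-- `u` is abnormal: it is a singular point of the end-point mapping. -/
def IsAbnormal (u : Control m T) : Prop := ¬ Function.Surjective (dEndpoint f₀ f T u)

/-- The codimension of `Im dE(u)` in `ℝⁿ`. -/
def corank (u : Control m T) : ℕ :=
  Module.finrank ℝ (State n ⧸ LinearMap.range (dEndpoint f₀ f T u).toLinearMap)

/-- A nonzero pair `(q, c)` is a Lagrange multiplier of `u`: `q ∘ dE(u) = - c dC(u)`. -/
def IsLagrangeMultiplier (u : Control m T) (q : Covector n) (c : ℝ) : Prop :=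
  (q, c) ≠ 0 ∧ q ∘L dEndpoint f₀ f T u = (-c) • fderiv ℝ (cost T) u

/-- `P` is a normal point: the end-point of a minimizing trajectory that has a Lagrange
multiplier `(q, c)` with `c ≠ 0`. -/
def IsNormalPoint (P : State n) : Prop :=
  ∃ u : Control m T, IsMinimizing f₀ f T u ∧ endpoint f₀ f T u = P ∧
    ∃ (q : Covector n) (c : ℝ), c ≠ 0 ∧ IsLagrangeMultiplier f₀ f T u q c

/-- `(x, p)` solves on `[0,T]` the Hamiltonian system of
`H = ⟨p, f₀(x) + ∑ i, u_i f_i(x)⟩ - ½ ∑ i, u_i²` with the normal control `u_i = ⟨p, f_i(x)⟩`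
(that is, `∂H/∂u = 0`), with `x(0) = 0` and `p(0) = p₀`. -/
def IsNormalExtremal (p₀ : Covector n) (x : ℝ → State n) (p : ℝ → Covector n) : Prop :=
  x 0 = 0 ∧ p 0 = p₀ ∧ ∀ t ∈ Icc (0 : ℝ) T,
    HasDerivWithinAt x (f₀ (x t) + ∑ i, p t (f i (x t)) • f i (x t)) (Icc 0 T) t ∧
    HasDerivWithinAt p
      (-(p t ∘L (fderiv ℝ f₀ (x t) + ∑ i, p t (f i (x t)) • fderiv ℝ (f i) (x t)))) (Icc 0 T) t

/-- The initial covectors whose normal extremal exists on all of `[0,T]`. -/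
def normalDomain : Set (Covector n) :=
  {p₀ | ∃ x p, IsNormalExtremal f₀ f T p₀ x p}

/-- The feedback `u_i(t) = ⟨p(t), f_i(x(t))⟩`. -/
def normalControl (x : ℝ → State n) (p : ℝ → Covector n) (t : ℝ) : EuclideanSpace ℝ (Fin m) :=
  WithLp.toLp 2 fun i => p t (f i (x t))

theorem memLp_normalControl {f : Fin m → State n → State n} (hf : ∀ i, Continuous (f i))
    {p₀ : Covector n} {x : ℝ → State n} {p : ℝ → Covector n}
    (h : IsNormalExtremal f₀ f T p₀ x p) :
    MemLp (normalControl f x p) 2 (volume.restrict (Icc (0 : ℝ) T)) := by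
  have hx : ContinuousOn x (Icc 0 T) := fun t ht => (h.2.2 t ht).1.continuousWithinAt
  have hp : ContinuousOn p (Icc 0 T) := fun t ht => (h.2.2 t ht).2.continuousWithinAt
  have hc : ContinuousOn (normalControl f x p) (Icc 0 T) := by
    refine (PiLp.continuous_toLp 2 _).comp_continuousOn (continuousOn_pi.2 fun i => ?_)
    exact hp.clm_apply ((hf i).comp_continuousOn hx)
  obtain ⟨B, hB⟩ := isCompact_Icc.exists_bound_of_continuousOn hc
  exact MemLp.of_bound (hc.aestronglyMeasurable measurableSet_Icc) B
    ((ae_restrict_iff' measurableSet_Icc).2 (.of_forall hB))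

/-- The mapping `Φ : p(0) ↦ u_{p(0)}`, from initial covectors to normal controls in `L²`. -/
def normalMap (hf : ∀ i, Continuous (f i)) (p₀ : normalDomain f₀ f T) : Control m T :=
  (memLp_normalControl f₀ T hf p₀.2.choose_spec.choose_spec).toLp

/-- The generalized exponential mapping `exp = E ∘ Φ`, on its domain of definition. -/
def expMap (hf : ∀ i, Continuous (f i)) (p₀ : normalDomain f₀ f T) : State n :=
  endpoint f₀ f T (normalMap f₀ f T hf p₀)

end

end AffineControl

end

/-! Assume that `exp` is proper and let `u` be the abnormal minimizer over `A`. Call a control `v`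
normal if `⟪v, ·⟫ = l ∘ dE(v)` for some covector `l` at the end-point. Transporting `l` back by the
adjoint equation gives an initial covector whose normal extremal has control `v`.

First, `u` is not normal. Otherwise a nonzero `q` annihilating `Im dE(u)` could be added to `l` in
any multiple, and the fibre of `exp` over `A` would contain a whole affine line
(`not_isCompact_fibre`). Second, no control near `u` is normal (`eventually_not_isNormalControl`):
for normal controls tending to `u`, properness bounds the initial covectors, Gronwall bounds the
final ones, and a limit of these would make `u` normal.

Hence `u` is the only element of least norm in its fibre within a small ball. Another one would also
be minimizing. If abnormal, it would have corank 1 by semicontinuity of the rank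
(`eventually_corank_eq_one`), against uniqueness. If not abnormal, it would be normal by Lagrange
multipliers, which is excluded.

Now minimize `‖v‖² + k‖E(v) - A‖²` over that ball. Minimizers exist because `E` is weakly
sequentially continuous there, and by uniqueness they converge strongly to `u` as `k → ∞`
(`exists_tendsto_isMinOn_penalized`). Eventually they are interior, and the first-order condition
says that they are normal controls: a contradiction.

The analytic input (strict differentiability and weak continuity of `E`, the adjoint formula for
`dE`) comes from the state equation written as a fixed-point equation in `C([0,T])`, whose
linearization is one minus a quasi-nilpotent Volterra operator. -/

noncomputable section

namespace AffineControl

set_option linter.unusedSectionVars false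
set_option maxSynthPendingDepth 3

open Filter
open scoped RealInnerProductSpace

/-! ### L² controls: Cauchy–Schwarz estimates and Gronwall's inequality -/

section Basics

variable {T : ℝ} {S S' W : Type*}
  [NormedAddCommGroup S] [NormedSpace ℝ S]
  [NormedAddCommGroup S'] [NormedSpace ℝ S']
  [NormedAddCommGroup W] [NormedSpace ℝ W]

/-- Lebesgue measure on the time interval. -/
abbrev timeMeasure (T : ℝ) : Measure ℝ := volume.restrict (Icc (0 : ℝ) T)

theorem norm_sq_eq_integral (v : Lp W 2 (timeMeasure T)) :
    ‖v‖ ^ 2 = ∫ s, ‖v s‖ ^ 2 ∂(timeMeasure T) := by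
  rw [Lp.norm_def, (Lp.memLp v).eLpNorm_eq_integral_rpow_norm (by norm_num) (by norm_num)]
  have h : 0 ≤ ∫ s, ‖v s‖ ^ 2 ∂(timeMeasure T) := integral_nonneg fun _ => by positivity
  simp only [ENNReal.toReal_ofNat, Real.rpow_ofNat]
  rw [ENNReal.toReal_ofReal (by positivity), ← one_div, ← Real.sqrt_eq_rpow, Real.sq_sqrt h]

theorem integrable_control (v : Lp W 2 (timeMeasure T)) : Integrable v (timeMeasure T) :=
  (Lp.memLp v).integrable (by norm_num)

theorem integrable_norm_sq_control (v : Lp W 2 (timeMeasure T)) :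
    Integrable (fun s => ‖v s‖ ^ 2) (timeMeasure T) := by
  simpa using (Lp.memLp v).integrable_norm_pow (p := 2) (by norm_num)

theorem restrict_Ioc_le {t : ℝ} (ht : t ∈ Icc (0 : ℝ) T) :
    volume.restrict (Ioc (0 : ℝ) t) ≤ timeMeasure T :=
  Measure.restrict_mono_set _ fun _ hs => ⟨hs.1.le, hs.2.trans ht.2⟩

theorem integrable_apply_control {g : ℝ → W →L[ℝ] S} (hg : Continuous g)
    (v : Lp W 2 (timeMeasure T)) : Integrable (fun s => g s (v s)) (timeMeasure T) := by
  obtain ⟨B, hB⟩ := isCompact_Icc.exists_bound_of_continuousOn (s := Icc (0 : ℝ) T)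
    hg.continuousOn
  refine Integrable.mono' ((integrable_control v).norm.const_mul B) ?_ ?_
  · exact (ContinuousLinearMap.id ℝ (W →L[ℝ] S)).aestronglyMeasurable_comp₂
      hg.aestronglyMeasurable (Lp.aestronglyMeasurable v)
  · refine (ae_restrict_iff' measurableSet_Icc).2 (.of_forall fun s hs => ?_)
    exact (g s).le_of_opNorm_le (hB s hs) _

theorem intervalIntegrable_apply_control {g : ℝ → W →L[ℝ] S} (hg : Continuous g)
    (v : Lp W 2 (timeMeasure T)) {t : ℝ} (ht : t ∈ Icc (0 : ℝ) T) :
    IntervalIntegrable (fun s => g s (v s)) volume 0 t := by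
  rw [intervalIntegrable_iff_integrableOn_Ioc_of_le ht.1]
  exact (integrable_apply_control hg v).mono_measure (restrict_Ioc_le ht)

/-- Cauchy–Schwarz on `[0,t]`. An L² control has no pointwise bound, so Gronwall is later run on
squared norms. Keeping `∫₀ᵗ a²` on the right is what makes this possible. -/
theorem sq_integral_mul_le {a : ℝ → ℝ} (ha : Continuous a) (ha0 : ∀ s, 0 ≤ a s)
    (v : Lp W 2 (timeMeasure T)) {t : ℝ} (ht : t ∈ Icc (0 : ℝ) T) :
    (∫ s in (0 : ℝ)..t, a s * ‖v s‖) ^ 2 ≤ ‖v‖ ^ 2 * ∫ s in (0 : ℝ)..t, a s ^ 2 := by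
  simp only [intervalIntegral.integral_of_le ht.1]
  have hv : MemLp (fun s => ‖v s‖) 2 (volume.restrict (Ioc (0 : ℝ) t)) :=
    (Lp.memLp v).norm.mono_measure (restrict_Ioc_le ht)
  have hA : MemLp a 2 (volume.restrict (Ioc (0 : ℝ) t)) := by
    obtain ⟨B, hB⟩ := isCompact_Icc.exists_bound_of_continuousOn (s := Icc (0 : ℝ) t)
      ha.continuousOn
    refine MemLp.of_bound ha.aestronglyMeasurable B
      ((ae_restrict_iff' measurableSet_Ioc).2 (.of_forall fun s hs => hB s ⟨hs.1.le, hs.2⟩))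
  have h := integral_mul_le_Lp_mul_Lq_of_nonneg (μ := volume.restrict (Ioc (0 : ℝ) t))
    (p := 2) (q := 2) ⟨by norm_num, by norm_num, by norm_num⟩ (.of_forall ha0)
    (.of_forall fun s => norm_nonneg (v s)) (by simpa using hA) (by simpa using hv)
  simp only [Real.rpow_ofNat, ← Real.sqrt_eq_rpow] at h
  have h0 : 0 ≤ ∫ s in Ioc (0 : ℝ) t, a s * ‖v s‖ :=
    integral_nonneg fun s => mul_nonneg (ha0 s) (norm_nonneg _)
  have h1 : 0 ≤ ∫ s in Ioc (0 : ℝ) t, a s ^ 2 := integral_nonneg fun s => by positivity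
  have h2 : 0 ≤ ∫ s in Ioc (0 : ℝ) t, ‖v s‖ ^ 2 := integral_nonneg fun s => by positivity
  have h3 : ∫ s in Ioc (0 : ℝ) t, ‖v s‖ ^ 2 ≤ ‖v‖ ^ 2 := by
    rw [norm_sq_eq_integral]
    exact integral_mono_measure (restrict_Ioc_le ht) (.of_forall fun s => by positivity)
      (integrable_norm_sq_control v)
  calc _ ≤ (√(∫ s in Ioc (0 : ℝ) t, a s ^ 2) * √(∫ s in Ioc (0 : ℝ) t, ‖v s‖ ^ 2)) ^ 2 := by
        gcongr
    _ = (∫ s in Ioc (0 : ℝ) t, ‖v s‖ ^ 2) * ∫ s in Ioc (0 : ℝ) t, a s ^ 2 := by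
        rw [mul_pow, Real.sq_sqrt h1, Real.sq_sqrt h2, mul_comm]
    _ ≤ _ := by gcongr

theorem norm_sq_integral_apply_le {g : ℝ → W →L[ℝ] S} (hg : Continuous g)
    (v : Lp W 2 (timeMeasure T)) {t : ℝ} (ht : t ∈ Icc (0 : ℝ) T) :
    ‖∫ s in (0 : ℝ)..t, g s (v s)‖ ^ 2 ≤ ‖v‖ ^ 2 * ∫ s in (0 : ℝ)..t, ‖g s‖ ^ 2 := by
  refine le_trans ?_ (sq_integral_mul_le hg.norm (fun _ => norm_nonneg _) v ht)
  gcongr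
  refine intervalIntegral.norm_integral_le_of_norm_le ht.1
    (.of_forall fun s _ => (g s).le_opNorm _) ?_
  have := integrable_control v
  rw [intervalIntegrable_iff_integrableOn_Ioc_of_le ht.1]
  refine IntegrableOn.continuousOn_mul_of_subset (K := Icc 0 t) hg.norm.continuousOn
    (this.norm.mono_measure (restrict_Ioc_le ht)) isCompact_Icc
    measurableSet_Ioc Ioc_subset_Icc_self

theorem norm_integral_apply_le {g : ℝ → W →L[ℝ] S} (hg : Continuous g)
    (v : Lp W 2 (timeMeasure T)) {t C : ℝ} (ht : t ∈ Icc (0 : ℝ) T) (hC : 0 ≤ C)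
    (hgC : ∀ s, ‖g s‖ ≤ C) :
    ‖∫ s in (0 : ℝ)..t, g s (v s)‖ ≤ √T * C * ‖v‖ := by
  have hT : 0 ≤ T := ht.1.trans ht.2
  refine le_of_sq_le_sq ?_ (by positivity)
  refine (norm_sq_integral_apply_le hg v ht).trans ?_
  have : ∫ s in (0 : ℝ)..t, ‖g s‖ ^ 2 ≤ ∫ s in (0 : ℝ)..t, C ^ 2 := by
    refine intervalIntegral.integral_mono_on ht.1 ?_ ?_ fun s _ => ?_
    · exact (hg.norm.pow 2).intervalIntegrable _ _
    · exact continuous_const.intervalIntegrable _ _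
    · gcongr; exact hgC s
  rw [intervalIntegral.integral_const, smul_eq_mul, sub_zero] at this
  rw [mul_pow, mul_pow, Real.sq_sqrt hT, mul_comm]
  gcongr
  refine this.trans ?_
  gcongr
  exact ht.2

/-- Integral form of Gronwall's inequality. -/
theorem integral_le_of_le_add_integral {F a : ℝ → ℝ} (hF : Continuous F) (ha : Continuous a)
    {K : ℝ} (hK : 0 ≤ K) (ha0 : ∀ s, 0 ≤ a s)
    (h : ∀ t ∈ Icc 0 T, F t ≤ a t + K * ∫ s in (0 : ℝ)..t, F s) :
    ∀ t ∈ Icc 0 T, ∫ s in (0 : ℝ)..t, F s ≤ Real.exp (K * t) * ∫ s in (0 : ℝ)..t, a s := by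
  have hd (G : ℝ → ℝ) (hG : Continuous G) (t : ℝ) :
      HasDerivAt (fun t => ∫ s in (0 : ℝ)..t, G s) (G t) t :=
    hG.integral_hasStrictDerivAt 0 t |>.hasDerivAt
  -- With the integrating factor, `D(0) = 0` and `D' ≥ (1 - e^{-Kt}) a ≥ 0`; positivity of `F` plays
  -- no role.
  let D : ℝ → ℝ := fun t => (∫ s in (0 : ℝ)..t, a s) - Real.exp (-K * t) * ∫ s in (0 : ℝ)..t, F s
  have hD : ∀ t, HasDerivAt D (a t - (Real.exp (-K * t) * (-K) * (∫ s in (0 : ℝ)..t, F s)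
      + Real.exp (-K * t) * F t)) t := fun t => by
    have he : HasDerivAt (fun t : ℝ => Real.exp (-K * t)) (Real.exp (-K * t) * (-K)) t := by
      simpa using ((hasDerivAt_id t).const_mul (-K)).exp
    exact (hd a ha t).sub (he.mul (hd F hF t))
  have hmono : MonotoneOn D (Icc 0 T) := by
    refine monotoneOn_of_deriv_nonneg (convex_Icc 0 T)
      (fun t _ => (hD t).continuousAt.continuousWithinAt)
      (fun t _ => (hD t).differentiableAt.differentiableWithinAt) fun t ht => ?_
    rw [interior_Icc] at ht
    rw [(hD t).deriv]
    have h1 := h t ⟨ht.1.le, ht.2.le⟩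
    have h2 : Real.exp (-K * t) ≤ 1 := Real.exp_le_one_iff.2 (by nlinarith [ht.1])
    have h3 := Real.exp_pos (-K * t)
    nlinarith [ha0 t, mul_le_mul_of_nonneg_left h1 h3.le, mul_nonneg (sub_nonneg.2 h2) (ha0 t)]
  intro t ht
  have h0 := hmono ⟨le_rfl, ht.1.trans ht.2⟩ ht ht.1
  simp only [D, intervalIntegral.integral_same, mul_zero, sub_zero] at h0
  have h3 := Real.exp_pos (K * t)
  have h4 : Real.exp (K * t) * Real.exp (-K * t) = 1 := by rw [← Real.exp_add]; simp
  calc ∫ s in (0 : ℝ)..t, F s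
      = Real.exp (K * t) * (Real.exp (-K * t) * ∫ s in (0 : ℝ)..t, F s) := by
        rw [← mul_assoc, h4, one_mul]
    _ ≤ _ := by gcongr; linarith

end Basics

/-! ### Differentiability of superposition operators on `C(I, E)` -/

section Nemytskii

variable {I E F : Type*} [TopologicalSpace I] [CompactSpace I]
  [NormedAddCommGroup E] [NormedSpace ℝ E] [NormedAddCommGroup F] [NormedSpace ℝ F]

/-- A continuous family of continuous linear maps acts on continuous maps. -/
def pointwiseApply (N : C(I, E →L[ℝ] F)) : C(I, E) →L[ℝ] C(I, F) :=
  LinearMap.mkContinuous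
    { toFun := fun y => ⟨fun t => N t (y t), N.continuous.clm_apply y.continuous⟩
      map_add' := fun y z => by ext t; simp
      map_smul' := fun c y => by ext t; simp } ‖N‖ fun y => by
    refine (ContinuousMap.norm_le _ (by positivity)).2 fun t => ?_
    exact (N t).le_of_opNorm_le_of_le (N.norm_coe_le_norm t) (y.norm_coe_le_norm t)

@[simp]
theorem pointwiseApply_apply (N : C(I, E →L[ℝ] F)) (y : C(I, E)) (t : I) :
    pointwiseApply N y t = N t (y t) := rfl

/-- Post-composition of a continuous map on a compact space with a `C¹` map is strictly
differentiable in the continuous map. -/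
theorem hasStrictFDerivAt_comp_left {f : E → F} (hf : ContDiff ℝ 1 f) (x : C(I, E)) :
    HasStrictFDerivAt (fun y : C(I, E) => (⟨f, hf.continuous⟩ : C(E, F)).comp y)
      (pointwiseApply ((⟨fderiv ℝ f, hf.continuous_fderiv (by norm_num)⟩ : C(E, E →L[ℝ] F)).comp x))
      x := by
  rw [hasStrictFDerivAt_iff_isLittleO, Asymptotics.isLittleO_iff]
  intro ε hε
  -- Compactness of the range makes the continuity of `fderiv ℝ f` uniform near it, so one `δ`
  -- serves all times.
  have hK : IsCompact (range x) := isCompact_range x.continuous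
  have hu := hK.uniformContinuousAt_of_continuousAt (fderiv ℝ f)
    (fun a _ => (hf.continuous_fderiv (by norm_num)).continuousAt) (Metric.dist_mem_uniformity hε)
  obtain ⟨δ, hδ, hu⟩ := Metric.mem_uniformity_dist.1 hu
  have hb : ∀ᶠ p in 𝓝 (x, x), p ∈ Metric.ball x δ ×ˢ Metric.ball x δ :=
    prod_mem_nhds (Metric.ball_mem_nhds x hδ) (Metric.ball_mem_nhds x hδ)
  filter_upwards [hb] with p hp
  refine (ContinuousMap.norm_le _ (by positivity)).2 fun t => ?_
  have hmem (z : C(I, E)) (hz : z ∈ Metric.ball x δ) : z t ∈ Metric.ball (x t) δ :=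
    (ContinuousMap.dist_apply_le_dist t).trans_lt hz
  have h := (convex_ball (x t) δ).norm_image_sub_le_of_norm_fderiv_le' (𝕜 := ℝ) (f := f)
    (φ := fderiv ℝ f (x t)) (C := ε) (fun z _ => hf.differentiable (by norm_num) z)
    (fun z hz => ?_) (hmem p.2 hp.2) (hmem p.1 hp.1)
  · refine h.trans ?_
    gcongr
    exact (p.1 - p.2).norm_coe_le_norm t
  · rw [← dist_eq_norm, dist_comm]
    exact (hu (a := x t) (b := z) (by rw [dist_comm]; exact hz) ⟨t, rfl⟩).le

end Nemytskii

/-! ### Volterra operators with L² kernels -/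

section Volterra

variable {T : ℝ} (hT : 0 ≤ T) {S S' W : Type*}
  [NormedAddCommGroup S] [NormedSpace ℝ S]
  [NormedAddCommGroup S'] [NormedSpace ℝ S']
  [NormedAddCommGroup W] [NormedSpace ℝ W]

theorem continuous_extend {hT : 0 ≤ T} (x : C(Icc (0 : ℝ) T, S)) :
    Continuous (IccExtend hT x) := x.continuous.Icc_extend'

theorem norm_extend_le {hT : 0 ≤ T} (x : C(Icc (0 : ℝ) T, S)) (s : ℝ) :
    ‖IccExtend hT x s‖ ≤ ‖x‖ := x.norm_coe_le_norm _

/-- The bilinear map `(g, v) ↦ (t ↦ ∫₀ᵗ g(s) v(s) ds)`. -/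
def controlIntegral : C(Icc (0 : ℝ) T, W →L[ℝ] S) →L[ℝ]
    Lp W 2 (timeMeasure T) →L[ℝ] C(Icc (0 : ℝ) T, S) :=
  LinearMap.mkContinuous₂
    (LinearMap.mk₂ ℝ
      (fun (g : C(Icc (0 : ℝ) T, W →L[ℝ] S)) (v : Lp W 2 (timeMeasure T)) =>
        (⟨fun t => ∫ s in (0 : ℝ)..t, IccExtend hT g s (v s), by
          have h := intervalIntegral.continuousOn_primitive_interval (a := 0) (b := T)
            (f := fun s => IccExtend hT g s (v s)) (μ := volume)
            (by rw [uIcc_of_le hT]; exact integrable_apply_control (continuous_extend g) v)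
          rw [uIcc_of_le hT] at h
          exact continuousOn_iff_continuous_domRestrict.1 h⟩ : C(Icc (0 : ℝ) T, S)))
      (fun g g' v => by
        ext t
        refine (intervalIntegral.integral_congr fun s _ => ?_).trans
          (intervalIntegral.integral_add
            (intervalIntegrable_apply_control (continuous_extend (hT := hT) g) v t.2)
            (intervalIntegrable_apply_control (continuous_extend (hT := hT) g') v t.2))
        simp [IccExtend])
      (fun c g v => by
        ext t
        refine (intervalIntegral.integral_congr fun s _ => ?_).trans
          (intervalIntegral.integral_smul c _)
        simp [IccExtend])
      (fun g v v' => by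
        ext t
        refine (intervalIntegral.integral_congr_ae_restrict ?_).trans
          (intervalIntegral.integral_add
            (intervalIntegrable_apply_control (continuous_extend (hT := hT) g) v t.2)
            (intervalIntegrable_apply_control (continuous_extend (hT := hT) g) v' t.2))
        rw [uIoc_of_le t.2.1]
        filter_upwards [ae_mono (restrict_Ioc_le t.2) (Lp.coeFn_add v v')] with s hs
        rw [hs, Pi.add_apply, map_add])
      (fun c g v => by
        ext t
        refine (intervalIntegral.integral_congr_ae_restrict ?_).trans
          (intervalIntegral.integral_smul c _)
        rw [uIoc_of_le t.2.1]
        filter_upwards [ae_mono (restrict_Ioc_le t.2) (Lp.coeFn_smul c v)] with s hs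
        rw [hs, Pi.smul_apply, map_smul]))
    (√T) fun g v => by
      refine (ContinuousMap.norm_le _ (by positivity)).2 fun t => ?_
      exact norm_integral_apply_le (continuous_extend g) v t.2 (norm_nonneg g) (norm_extend_le g)

theorem controlIntegral_apply (g : C(Icc (0 : ℝ) T, W →L[ℝ] S)) (v : Lp W 2 (timeMeasure T))
    (t : Icc (0 : ℝ) T) :
    controlIntegral hT g v t = ∫ s in (0 : ℝ)..t, IccExtend hT g s (v s) := rfl

/-- The Volterra operator `y ↦ (t ↦ ∫₀ᵗ N(s)(y(s))(v(s)) ds)`. -/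
def volterra (N : C(Icc (0 : ℝ) T, S →L[ℝ] W →L[ℝ] S')) (v : Lp W 2 (timeMeasure T)) :
    C(Icc (0 : ℝ) T, S) →L[ℝ] C(Icc (0 : ℝ) T, S') :=
  (controlIntegral hT).flip v ∘L pointwiseApply N

theorem volterra_apply (N : C(Icc (0 : ℝ) T, S →L[ℝ] W →L[ℝ] S')) (v : Lp W 2 (timeMeasure T))
    (y : C(Icc (0 : ℝ) T, S)) (t : Icc (0 : ℝ) T) :
    volterra hT N v y t = ∫ s in (0 : ℝ)..t, IccExtend hT N s (IccExtend hT y s) (v s) := rfl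

theorem norm_sq_volterra_apply_le (N : C(Icc (0 : ℝ) T, S →L[ℝ] W →L[ℝ] S'))
    (v : Lp W 2 (timeMeasure T)) (y : C(Icc (0 : ℝ) T, S)) (t : Icc (0 : ℝ) T) :
    ‖volterra hT N v y t‖ ^ 2
      ≤ (‖v‖ * ‖N‖) ^ 2 * ∫ s in (0 : ℝ)..t, ‖IccExtend hT y s‖ ^ 2 := by
  have hg := continuous_extend (hT := hT) (pointwiseApply N y)
  refine (norm_sq_integral_apply_le hg v t.2).trans ?_
  rw [mul_pow, mul_assoc]
  refine mul_le_mul_of_nonneg_left ?_ (by positivity)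
  rw [← intervalIntegral.integral_const_mul]
  refine intervalIntegral.integral_mono_on t.2.1 ((hg.norm.pow 2).intervalIntegrable _ _)
    ((((continuous_extend y).norm.pow 2).const_mul _).intervalIntegrable _ _) fun s _ => ?_
  rw [← mul_pow]
  gcongr
  exact (IccExtend hT N s).le_of_opNorm_le (norm_extend_le N s) _

/-- Each further application integrates `s ^ k` to `t ^ (k + 1) / (k + 1)`, which builds up the
factorial. -/
theorem norm_sq_volterra_pow_apply_le (N : C(Icc (0 : ℝ) T, S →L[ℝ] W →L[ℝ] S))
    (v : Lp W 2 (timeMeasure T)) (y : C(Icc (0 : ℝ) T, S)) (k : ℕ) (t : Icc (0 : ℝ) T) :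
    ‖(volterra hT N v ^ k) y t‖ ^ 2
      ≤ ((‖v‖ * ‖N‖) ^ 2 * t) ^ k / k.factorial * ‖y‖ ^ 2 := by
  induction k generalizing t with
  | zero => simpa using pow_le_pow_left₀ (norm_nonneg _) (y.norm_coe_le_norm t) 2
  | succ k ih =>
    rw [pow_succ' (volterra hT N v)]
    refine (norm_sq_volterra_apply_le hT N v _ t).trans ?_
    set c := (‖v‖ * ‖N‖) ^ 2
    have hc : 0 ≤ c := by positivity
    have h : ∫ s in (0 : ℝ)..t, ‖IccExtend hT ((volterra hT N v ^ k) y) s‖ ^ 2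
        ≤ ∫ s in (0 : ℝ)..t, (c ^ k / k.factorial * ‖y‖ ^ 2) * s ^ k := by
      refine intervalIntegral.integral_mono_on t.2.1
        (((continuous_extend _).norm.pow 2).intervalIntegrable _ _)
        (((continuous_pow k).const_mul _).intervalIntegrable _ _) fun s hs => ?_
      have hs' : s ∈ Icc (0 : ℝ) T := ⟨hs.1, hs.2.trans t.2.2⟩
      rw [IccExtend_of_mem _ _ hs']
      refine (ih ⟨s, hs'⟩).trans (le_of_eq ?_)
      rw [mul_pow]; ring
    rw [intervalIntegral.integral_const_mul, integral_pow] at h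
    refine (mul_le_mul_of_nonneg_left h hc).trans (le_of_eq ?_)
    rw [Nat.factorial_succ]
    push_cast
    field_simp
    ring

/-- The factorial decay makes some power of `V` a strict contraction, with no smallness of `T` or
`v`. Then `1 - V` is a unit, being a factor of `1 - V ^ k` that commutes with the cofactor. -/
theorem isUnit_one_sub_volterra [CompleteSpace S] (N : C(Icc (0 : ℝ) T, S →L[ℝ] W →L[ℝ] S))
    (v : Lp W 2 (timeMeasure T)) : IsUnit (1 - volterra hT N v) := by
  set V := volterra hT N v
  have h := FloorSemiring.tendsto_pow_div_factorial_atTop ((‖v‖ * ‖N‖) ^ 2 * T)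
  obtain ⟨k, hk⟩ := (h.eventually_lt_const (show (0 : ℝ) < 1 / 4 by norm_num)).exists
  have hV : ‖V ^ k‖ < 1 := by
    suffices h : ‖V ^ k‖ ≤ 1 / 2 by linarith
    refine (V ^ k).opNorm_le_bound (by norm_num) fun y => ?_
    refine (ContinuousMap.norm_le _ (by positivity)).2 fun t => ?_
    refine le_of_sq_le_sq ?_ (by positivity)
    refine (norm_sq_volterra_pow_apply_le hT N v y k t).trans ?_
    rw [mul_pow (1 / 2 : ℝ)]
    refine mul_le_mul_of_nonneg_right ?_ (sq_nonneg _)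
    have ht0 : (0 : ℝ) ≤ t := t.2.1
    refine le_trans ?_ (hk.le.trans (by norm_num))
    gcongr
    exact t.2.2
  have h1 : IsUnit (1 - V ^ k) := isUnit_one_sub_of_norm_lt_one
    (R := C(Icc (0 : ℝ) T, S) →L[ℝ] C(Icc (0 : ℝ) T, S)) hV
  have h2 := (Commute.one_left V).mul_geom_sum₂ k
  rw [one_pow] at h2
  rw [← h2] at h1
  have hc : Commute (1 - V) (∑ i ∈ Finset.range k, 1 ^ i * V ^ (k - 1 - i)) := by
    refine Commute.sum_right _ _ _ fun i _ => ?_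
    simp only [one_pow, one_mul]
    exact ((Commute.one_left V).sub_left (Commute.refl V)).pow_right _
  exact (hc.isUnit_mul_iff.1 h1).1

end Volterra

/-! ### The state equation: differentiable and weakly continuous dependence on the control -/

section StateEquation

variable {T : ℝ} (hT : 0 ≤ T) {S W : Type*}
  [NormedAddCommGroup S] [NormedSpace ℝ S] [NormedAddCommGroup W] [NormedSpace ℝ W]

/-- The continuous family `t ↦ M(x(t))`. -/
abbrev alongCurve {E F : Type*} [NormedAddCommGroup E] [NormedAddCommGroup F] {M : E → F}
    (hM : Continuous M) (x : C(Icc (0 : ℝ) T, E)) : C(Icc (0 : ℝ) T, F) :=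
  (⟨M, hM⟩ : C(E, F)).comp x

/-- `x` solves `x(t) = ∫₀ᵗ M(x(s)) v(s) ds` on `[0,T]`. -/
def IsSolution {M : S → W →L[ℝ] S} (hM : Continuous M) (v : Lp W 2 (timeMeasure T))
    (x : C(Icc (0 : ℝ) T, S)) : Prop :=
  controlIntegral hT (alongCurve hM x) v = x

variable {M : S → W →L[ℝ] S} (hM : ContDiff ℝ 1 M)

/-- The derivative of `M` along a curve. -/
abbrev derivAlong (x : C(Icc (0 : ℝ) T, S)) : C(Icc (0 : ℝ) T, S →L[ℝ] W →L[ℝ] S) :=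
  alongCurve (hM.continuous_fderiv (by norm_num)) x

theorem hasStrictFDerivAt_controlIntegral (v : Lp W 2 (timeMeasure T))
    (x : C(Icc (0 : ℝ) T, S)) :
    HasStrictFDerivAt (fun p : Lp W 2 (timeMeasure T) × C(Icc (0 : ℝ) T, S) =>
        controlIntegral hT (alongCurve hM.continuous p.2) p.1)
      (volterra hT (derivAlong hM x) v ∘L ContinuousLinearMap.snd ℝ _ _ +
        controlIntegral hT (alongCurve hM.continuous x) ∘L ContinuousLinearMap.fst ℝ _ _)
      (v, x) := by
  have h1 : HasStrictFDerivAt (fun p : Lp W 2 (timeMeasure T) × C(Icc (0 : ℝ) T, S) =>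
      alongCurve hM.continuous p.2)
      (pointwiseApply (derivAlong hM x) ∘L ContinuousLinearMap.snd ℝ _ _) (v, x) :=
    (hasStrictFDerivAt_comp_left hM x).comp (v, x) hasStrictFDerivAt_snd
  have h2 := (controlIntegral (S := S) (W := W) hT).hasStrictFDerivAt_of_bilinear h1
    (hasStrictFDerivAt_fst (𝕜 := ℝ) (E := Lp W 2 (timeMeasure T)) (F := C(Icc (0 : ℝ) T, S)))
  refine h2.congr_fderiv (ContinuousLinearMap.ext fun p => ?_)
  simp only [add_apply, ContinuousLinearMap.precompR_apply, ContinuousLinearMap.precompL_apply]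
  exact add_comm _ _

/-- Solutions of the state equation depend strictly differentiably on the control. -/
theorem IsSolution.exists_implicit [CompleteSpace S] [CompleteSpace W]
    {v : Lp W 2 (timeMeasure T)} {x : C(Icc (0 : ℝ) T, S)}
    (hx : IsSolution hT hM.continuous v x) :
    ∃ (φ : Lp W 2 (timeMeasure T) → C(Icc (0 : ℝ) T, S))
      (φ' : Lp W 2 (timeMeasure T) →L[ℝ] C(Icc (0 : ℝ) T, S)),
      φ v = x ∧ (∀ᶠ w in 𝓝 v, IsSolution hT hM.continuous w (φ w)) ∧
      HasStrictFDerivAt φ φ' v ∧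
      ∀ w, φ' w = volterra hT (derivAlong hM x) v (φ' w) +
        controlIntegral hT (alongCurve hM.continuous x) w := by
  set V := volterra hT (derivAlong hM x) v
  set J := controlIntegral hT (alongCurve hM.continuous x)
  let G : Lp W 2 (timeMeasure T) × C(Icc (0 : ℝ) T, S) → C(Icc (0 : ℝ) T, S) := fun p =>
    p.2 - controlIntegral hT (alongCurve hM.continuous p.2) p.1
  let G' : Lp W 2 (timeMeasure T) × C(Icc (0 : ℝ) T, S) →L[ℝ] C(Icc (0 : ℝ) T, S) :=
    ContinuousLinearMap.snd ℝ _ _ -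
      (V ∘L ContinuousLinearMap.snd ℝ _ _ + J ∘L ContinuousLinearMap.fst ℝ _ _)
  have hG : HasStrictFDerivAt G G' (v, x) :=
    hasStrictFDerivAt_snd.sub (hasStrictFDerivAt_controlIntegral hT hM v x)
  have hG0 : G (v, x) = 0 := sub_eq_zero.2 hx.symm
  -- The partial derivative in the trajectory is `1 - V`, so the implicit function theorem applies
  -- on all of `[0,T]` at once.
  have hinv : (G' ∘L .inr ℝ (Lp W 2 (timeMeasure T)) C(Icc (0 : ℝ) T, S)).IsInvertible := by
    have : G' ∘L .inr ℝ (Lp W 2 (timeMeasure T)) C(Icc (0 : ℝ) T, S) = 1 - V := by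
      ext y t
      simp [G']
    rw [this]
    obtain ⟨e, he⟩ := isUnit_one_sub_volterra hT (derivAlong hM x) v
    exact ⟨ContinuousLinearEquiv.ofUnit e, he⟩
  let φ := hG.implicitFunctionOfProdDomain hinv
  have hφ := hG.hasStrictFDerivAt_implicitFunctionOfProdDomain hinv
  have hsol : ∀ᶠ w in 𝓝 v, G (w, φ w) = 0 := by
    have := hG.eventually_apply_implicitFunctionOfProdDomain hinv
    rwa [hG0] at this
  have hφv : φ v = x :=
    (hG.eventually_apply_eq_iff_implicitFunctionOfProdDomain hinv).self_of_nhds.1 rfl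
  refine ⟨φ, _, hφv, hsol.mono fun w hw => (sub_eq_zero.1 hw).symm, hφ, fun w => ?_⟩
  set φ' : Lp W 2 (timeMeasure T) →L[ℝ] C(Icc (0 : ℝ) T, S) :=
    -(G' ∘L .inr ℝ _ _).inverse ∘L (G' ∘L .inl ℝ _ _)
  -- The linearized equation comes from differentiating `G(w, φ w) = 0`, which avoids computing with
  -- the inverse.
  have h1 : HasFDerivAt (fun w => G (w, φ w))
      (G' ∘L (ContinuousLinearMap.id ℝ _).prod φ') v := by
    have h2 : HasFDerivAt G G' (v, φ v) := by rw [hφv]; exact hG.hasFDerivAt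
    exact h2.comp v ((hasFDerivAt_id v).prodMk hφ.hasFDerivAt)
  have h2 : HasFDerivAt (fun w => G (w, φ w))
      (0 : Lp W 2 (timeMeasure T) →L[ℝ] C(Icc (0 : ℝ) T, S)) v :=
    (hasFDerivAt_const (0 : C(Icc (0 : ℝ) T, S)) v).congr_of_eventuallyEq hsol
  have h3 := DFunLike.congr_fun (h1.unique h2) w
  have h4 : φ' w - (V (φ' w) + J w) = 0 := h3
  exact sub_eq_zero.1 h4

theorem exists_lipschitz_on_ball [FiniteDimensional ℝ S] {F : Type*} [NormedAddCommGroup F]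
    [NormedSpace ℝ F] {f : S → F} (hf : ContDiff ℝ 1 f) (R : ℝ) :
    ∃ L : ℝ, 0 ≤ L ∧ ∀ a b, ‖a‖ ≤ R → ‖b‖ ≤ R → ‖f a - f b‖ ≤ L * ‖a - b‖ := by
  have := FiniteDimensional.proper_real S
  obtain ⟨K, hK⟩ :=
    (hf.locallyLipschitz (𝕂 := ℝ)).locallyLipschitzOn.exists_lipschitzOnWith_of_compact
    (isCompact_closedBall (0 : S) R)
  refine ⟨K, K.2, fun a b ha hb => ?_⟩
  simpa [dist_eq_norm] using hK.dist_le_mul a (by simpa using ha) b (by simpa using hb)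

/-- Comparison of the solutions of the state equation for two controls. -/
theorem IsSolution.norm_sq_sub_le {L R : ℝ}
    (hLip : ∀ a b, ‖a‖ ≤ R → ‖b‖ ≤ R → ‖M a - M b‖ ≤ L * ‖a - b‖)
    {v v' : Lp W 2 (timeMeasure T)} {x x' : C(Icc (0 : ℝ) T, S)}
    (hx : IsSolution hT hM.continuous v x) (hx' : IsSolution hT hM.continuous v' x')
    (hxR : ‖x‖ ≤ R) (hxR' : ‖x'‖ ≤ R) (t : Icc (0 : ℝ) T) :
    ‖x' t - x t‖ ^ 2 ≤
      2 * ‖controlIntegral hT (alongCurve hM.continuous x) (v' - v) t‖ ^ 2 +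
        2 * (L * ‖v'‖) ^ 2 * (Real.exp (2 * (L * ‖v'‖) ^ 2 * t) * ∫ s in (0 : ℝ)..t,
          2 * ‖IccExtend hT (controlIntegral hT (alongCurve hM.continuous x) (v' - v)) s‖ ^ 2) := by
  set g := controlIntegral hT (alongCurve hM.continuous x) (v' - v) with hg
  -- The difference of controls enters only through a term linear in it, with coefficient along the
  -- fixed curve `x`. Weak convergence therefore suffices later.
  have hd : x' - x =
      controlIntegral hT (alongCurve hM.continuous x' - alongCurve hM.continuous x) v' + g := by
    rw [hg, map_sub, map_sub, sub_apply, hx, hx']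
    abel
  have hF : Continuous fun s => ‖IccExtend hT (x' - x) s‖ ^ 2 :=
    (continuous_extend (hT := hT) (x' - x)).norm.pow 2
  have key (t : Icc (0 : ℝ) T) : ‖(x' - x) t‖ ^ 2 ≤ 2 * ‖g t‖ ^ 2 +
      2 * (L * ‖v'‖) ^ 2 * ∫ s in (0 : ℝ)..t, ‖IccExtend hT (x' - x) s‖ ^ 2 := by
    have h1 := norm_sq_integral_apply_le (continuous_extend (hT := hT)
      (alongCurve hM.continuous x' - alongCurve hM.continuous x)) v' t.2
    rw [← controlIntegral_apply hT] at h1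
    have h2 : ∫ s in (0 : ℝ)..t, ‖IccExtend hT
        (alongCurve hM.continuous x' - alongCurve hM.continuous x) s‖ ^ 2
        ≤ ∫ s in (0 : ℝ)..t, L ^ 2 * ‖IccExtend hT (x' - x) s‖ ^ 2 := by
      refine intervalIntegral.integral_mono_on t.2.1
        (((continuous_extend _).norm.pow 2).intervalIntegrable _ _)
        ((hF.const_mul _).intervalIntegrable _ _) fun s _ => ?_
      rw [← mul_pow]
      gcongr
      exact hLip _ _ ((x'.norm_coe_le_norm _).trans hxR') ((x.norm_coe_le_norm _).trans hxR)
    rw [intervalIntegral.integral_const_mul] at h2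
    have h3 := h1.trans (mul_le_mul_of_nonneg_left h2 (sq_nonneg ‖v'‖))
    have h4 : ‖(x' - x) t‖ ≤ ‖controlIntegral hT
        (alongCurve hM.continuous x' - alongCurve hM.continuous x) v' t‖ + ‖g t‖ := by
      conv_lhs => rw [hd]
      exact norm_add_le _ _
    have h5 := pow_le_pow_left₀ (norm_nonneg _) h4 2
    refine (h5.trans (add_sq_le)).trans ?_
    nlinarith
  refine (key t).trans (add_le_add_right (mul_le_mul_of_nonneg_left ?_ (by positivity)) _)
  refine integral_le_of_le_add_integral (T := T) hF
    (((continuous_extend (hT := hT) g).norm.pow 2).const_mul 2) (by positivity)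
    (fun s => mul_nonneg zero_le_two (sq_nonneg _)) (fun t ht => ?_) t t.2
  have := key ⟨t, ht⟩
  rwa [← IccExtend_of_mem hT (x' - x) ht, ← IccExtend_of_mem hT g ht] at this

theorem IsSolution.eq [FiniteDimensional ℝ S] {v : Lp W 2 (timeMeasure T)}
    {x x' : C(Icc (0 : ℝ) T, S)} (hx : IsSolution hT hM.continuous v x)
    (hx' : IsSolution hT hM.continuous v x') : x' = x := by
  obtain ⟨L, -, hLip⟩ := exists_lipschitz_on_ball hM (max ‖x‖ ‖x'‖)
  ext t
  have h := hx.norm_sq_sub_le hT hM hLip hx' (le_max_left _ _) (le_max_right _ _) t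
  have h0 : IccExtend hT (0 : C(Icc (0 : ℝ) T, S)) = 0 := rfl
  simp only [sub_self, map_zero, ContinuousMap.zero_apply, norm_zero, h0, Pi.zero_apply] at h
  norm_num at h
  exact sub_eq_zero.1 h

/-- Solutions converge pointwise when the controls converge weakly and the solutions are
bounded. -/
theorem IsSolution.tendsto_of_weak [FiniteDimensional ℝ S] {v : Lp W 2 (timeMeasure T)}
    {x : C(Icc (0 : ℝ) T, S)} (hx : IsSolution hT hM.continuous v x)
    {w : ℕ → Lp W 2 (timeMeasure T)} {y : ℕ → C(Icc (0 : ℝ) T, S)}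
    (hy : ∀ j, IsSolution hT hM.continuous (w j) (y j)) {B R : ℝ} (hw : ∀ j, ‖w j‖ ≤ B)
    (hyR : ∀ j, ‖y j‖ ≤ R)
    (hweak : ∀ ℓ : Lp W 2 (timeMeasure T) →L[ℝ] ℝ, Tendsto (fun j => ℓ (w j)) atTop (𝓝 (ℓ v)))
    (t : Icc (0 : ℝ) T) : Tendsto (fun j => y j t) atTop (𝓝 (x t)) := by
  obtain ⟨L, hL, hLip⟩ := exists_lipschitz_on_ball hM (max ‖x‖ R)
  set J := controlIntegral hT (alongCurve hM.continuous x)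
  have hB : 0 ≤ B := (norm_nonneg _).trans (hw 0)
  -- At each time the forcing term is a bounded linear map of the control into a finite-dimensional
  -- space, so weak convergence gives pointwise convergence. The integral in the comparison estimate
  -- then follows by dominated convergence.
  have hg (s : Icc (0 : ℝ) T) : Tendsto (fun j => ‖J (w j - v) s‖ ^ 2) atTop (𝓝 0) := by
    have h1 : Tendsto (fun j => J (w j) s) atTop (𝓝 (J v s)) := by
      let e := (Module.finBasis ℝ S).equivFunL
      have : Tendsto (fun j => e (J (w j) s)) atTop (𝓝 (e (J v s))) := by
        refine tendsto_pi_nhds.2 fun i => ?_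
        exact hweak ((ContinuousLinearMap.proj i ∘L (e : S →L[ℝ] (Fin (Module.finrank ℝ S) → ℝ))) ∘L
          (ContinuousMap.evalCLM ℝ s ∘L J))
      simpa [Function.comp_def] using (e.symm.continuous.tendsto _).comp this
    have h2 := (tendsto_sub_nhds_zero_iff.2 h1).norm.pow 2
    simpa using h2
  have hbd (j : ℕ) (s : ℝ) : ‖IccExtend hT (J (w j - v)) s‖ ≤ ‖J‖ * (B + ‖v‖) := by
    refine (norm_extend_le _ s).trans (J.le_opNorm_of_le ?_)
    exact (norm_sub_le _ _).trans (by gcongr; exact hw j)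
  have hI : Tendsto (fun j => ∫ s in (0 : ℝ)..t, 2 * ‖IccExtend hT (J (w j - v)) s‖ ^ 2) atTop
      (𝓝 (∫ s in (0 : ℝ)..t, (0 : ℝ))) := by
    refine intervalIntegral.tendsto_integral_filter_of_dominated_convergence
      (fun _ => 2 * (‖J‖ * (B + ‖v‖)) ^ 2) (.of_forall fun j => ?_) (.of_forall fun j =>
        .of_forall fun s _ => ?_) (by simp) (.of_forall fun s _ => ?_)
    · exact (((continuous_extend _).norm.pow 2).const_mul 2).aestronglyMeasurable
    · rw [Real.norm_of_nonneg (by positivity)]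
      gcongr
      exact hbd j s
    · have h := (hg (projIcc 0 T hT s)).const_mul 2
      rw [mul_zero] at h
      exact h
  rw [intervalIntegral.integral_zero] at hI
  have hmain (j : ℕ) : ‖y j t - x t‖ ^ 2 ≤ 2 * ‖J (w j - v) t‖ ^ 2 +
      2 * (L * B) ^ 2 * (Real.exp (2 * (L * B) ^ 2 * t) * ∫ s in (0 : ℝ)..t,
          2 * ‖IccExtend hT (J (w j - v)) s‖ ^ 2) := by
    refine (hx.norm_sq_sub_le hT hM hLip (hy j) (le_max_left _ _)
      ((hyR j).trans (le_max_right _ _)) t).trans ?_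
    have ht0 : (0 : ℝ) ≤ t := t.2.1
    have h0 : 0 ≤ ∫ s in (0 : ℝ)..t, 2 * ‖IccExtend hT (J (w j - v)) s‖ ^ 2 :=
      intervalIntegral.integral_nonneg t.2.1 fun s _ => by positivity
    have := hw j
    gcongr
  have hlim : Tendsto (fun j => ‖y j t - x t‖ ^ 2) atTop (𝓝 0) := by
    refine squeeze_zero (fun _ => by positivity) hmain ?_
    simpa using ((hg t).const_mul 2).add ((hI.const_mul _).const_mul _)
  refine tendsto_sub_nhds_zero_iff.1 (tendsto_zero_iff_norm_tendsto_zero.2 ?_)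
  simpa [Real.sqrt_sq] using hlim.sqrt

end StateEquation

/-! ### Integration by parts for primitives of integrable functions -/

section ProductRule

theorem absolutelyContinuous_const_add_integral {T : ℝ} {a : ℝ → ℝ} (hT : 0 ≤ T)
    (ha : IntervalIntegrable a volume 0 T) (A : ℝ) :
    AbsolutelyContinuousOnInterval (fun t => A + ∫ s in (0 : ℝ)..t, a s) 0 T := by
  have h : AbsolutelyContinuousOnInterval (fun _ : ℝ => A) 0 T :=
    ((LipschitzWith.const A).lipschitzOnWith (s := uIcc 0 T)).absolutelyContinuousOnInterval
  exact h.add (ha.absolutelyContinuousOnInterval_intervalIntegral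
    (by rw [uIcc_of_le hT]; exact ⟨le_rfl, hT⟩))

/-- The primitives are absolutely continuous, and their derivatives are the integrands almost
everywhere. -/
theorem integral_mul_add_mul_of_primitive {T : ℝ} (hT : 0 ≤ T) {a b α β : ℝ → ℝ} {A B : ℝ}
    (ha : IntervalIntegrable a volume 0 T) (hb : IntervalIntegrable b volume 0 T)
    (hα : ∀ t ∈ Icc 0 T, α t = A + ∫ s in (0 : ℝ)..t, a s)
    (hβ : ∀ t ∈ Icc 0 T, β t = B + ∫ s in (0 : ℝ)..t, b s) :
    ∫ s in (0 : ℝ)..T, (a s * β s + α s * b s) = α T * β T - A * B := by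
  have h := (absolutelyContinuous_const_add_integral hT ha A).integral_deriv_mul_eq_sub
    (absolutelyContinuous_const_add_integral hT hb B)
  simp only [intervalIntegral.integral_same, add_zero] at h
  rw [hα T ⟨hT, le_rfl⟩, hβ T ⟨hT, le_rfl⟩, ← h]
  refine intervalIntegral.integral_congr_ae ?_
  filter_upwards [ha.ae_hasDerivAt_integral, hb.ae_hasDerivAt_integral] with s h1 h2 hs
  have hs' := uIoc_subset_uIcc hs
  have h0 : (0 : ℝ) ∈ uIcc 0 T := left_mem_uIcc
  rw [((h1 hs' 0 h0).const_add A).deriv, ((h2 hs' 0 h0).const_add B).deriv]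
  rw [uIcc_of_le hT] at hs'
  rw [hα s hs', hβ s hs']

/-- The product rule, in integral form, for the pairing of two primitives. -/
theorem integral_pairing_of_primitive {T : ℝ} (hT : 0 ≤ T) {S : Type*} [NormedAddCommGroup S]
    [NormedSpace ℝ S] [FiniteDimensional ℝ S] {a α : ℝ → StrongDual ℝ S} {b β : ℝ → S}
    {A : StrongDual ℝ S} {B : S}
    (ha : IntervalIntegrable a volume 0 T) (hb : IntervalIntegrable b volume 0 T)
    (hα : ∀ t ∈ Icc 0 T, α t = A + ∫ s in (0 : ℝ)..t, a s)
    (hβ : ∀ t ∈ Icc 0 T, β t = B + ∫ s in (0 : ℝ)..t, b s) :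
    ∫ s in (0 : ℝ)..T, (a s (β s) + α s (b s)) = α T (β T) - A B := by
  have := FiniteDimensional.complete ℝ S
  let e := Module.finBasis ℝ S
  let c : Fin (Module.finrank ℝ S) → StrongDual ℝ S := fun i =>
    LinearMap.toContinuousLinearMap (e.coord i)
  -- Coordinates reduce the pairing to finitely many scalar products.
  have hexp (p : StrongDual ℝ S) (y : S) : p y = ∑ i, p (e i) * c i y := by
    have h : p y = p (∑ i, e.repr y i • e i) := by rw [e.sum_repr]
    rw [h, map_sum]
    exact Finset.sum_congr rfl fun i _ => (map_smul _ _ _).trans (mul_comm _ _)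
  have ha' (i) : IntervalIntegrable (fun s => a s (e i)) volume 0 T :=
    ⟨(ContinuousLinearMap.apply ℝ ℝ (e i)).integrable_comp ha.1,
      (ContinuousLinearMap.apply ℝ ℝ (e i)).integrable_comp ha.2⟩
  have hb' (i) : IntervalIntegrable (fun s => c i (b s)) volume 0 T :=
    ⟨(c i).integrable_comp hb.1, (c i).integrable_comp hb.2⟩
  have hsub {t : ℝ} (ht : t ∈ Icc 0 T) : uIcc 0 t ⊆ uIcc 0 T := by
    rw [uIcc_of_le ht.1, uIcc_of_le hT]
    exact Icc_subset_Icc_right ht.2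
  have hα' (i) : ∀ t ∈ Icc 0 T, α t (e i) = A (e i) + ∫ s in (0 : ℝ)..t, a s (e i) := fun t ht => by
    rw [hα t ht, add_apply]
    congr 1
    exact ((ContinuousLinearMap.apply ℝ ℝ (e i)).intervalIntegral_comp_comm
      (ha.mono_set (hsub ht))).symm
  have hβ' (i) : ∀ t ∈ Icc 0 T, c i (β t) = c i B + ∫ s in (0 : ℝ)..t, c i (b s) := fun t ht => by
    rw [hβ t ht, map_add]
    congr 1
    exact ((c i).intervalIntegral_comp_comm (hb.mono_set (hsub ht))).symm
  have hprod (i) := integral_mul_add_mul_of_primitive hT (ha' i) (hb' i) (hα' i) (hβ' i)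
  rw [hexp (α T), hexp A, ← Finset.sum_sub_distrib, ← Finset.sum_congr rfl fun i _ => hprod i,
    ← intervalIntegral.integral_finsetSum]
  · refine intervalIntegral.integral_congr fun s _ => ?_
    change a s (β s) + α s (b s) = ∑ i, (a s (e i) * c i (β s) + α s (e i) * c i (b s))
    rw [hexp (a s) (β s), hexp (α s) (b s), Finset.sum_add_distrib]
  · intro i _
    have hcont {γ c : ℝ → ℝ} {C : ℝ} (hc : IntervalIntegrable c volume 0 T)
        (h : ∀ t ∈ Icc 0 T, γ t = C + ∫ s in (0 : ℝ)..t, c s) : ContinuousOn γ (uIcc 0 T) := by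
      refine (absolutelyContinuous_const_add_integral hT hc C).continuousOn.congr ?_
      rwa [uIcc_of_le hT]
    exact ((ha' i).mul_continuousOn (hcont (hb' i) (hβ' i))).add
      ((hb' i).continuousOn_mul (hcont (ha' i) (hα' i)))

end ProductRule

/-! ### The adjoint equation -/

section Adjoint

variable {T : ℝ} (hT : 0 ≤ T) {S W : Type*}
  [NormedAddCommGroup S] [NormedSpace ℝ S] [NormedAddCommGroup W] [NormedSpace ℝ W]

/-- The coefficient of the adjoint equation: `(ψ, w) ↦ -ψ ∘ N(·)(w)`. -/
def adjointCoeff (N : S →L[ℝ] W →L[ℝ] S) : StrongDual ℝ S →L[ℝ] W →L[ℝ] StrongDual ℝ S :=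
  -((ContinuousLinearMap.compL ℝ W (S →L[ℝ] S) (StrongDual ℝ S)).flip N.flip ∘L
    ContinuousLinearMap.compL ℝ S S ℝ)

@[simp]
theorem adjointCoeff_apply (N : S →L[ℝ] W →L[ℝ] S) (ψ : StrongDual ℝ S) (w : W) (z : S) :
    adjointCoeff N ψ w z = -ψ (N z w) := rfl

theorem continuous_adjointCoeff :
    Continuous (adjointCoeff : (S →L[ℝ] W →L[ℝ] S) → _) := by
  unfold adjointCoeff
  have h : Continuous fun N : S →L[ℝ] W →L[ℝ] S => N.flip :=
    (ContinuousLinearMap.flipₗᵢ ℝ S W S).continuous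
  fun_prop

theorem norm_adjointCoeff_le (N : S →L[ℝ] W →L[ℝ] S) : ‖adjointCoeff N‖ ≤ ‖N‖ := by
  refine ContinuousLinearMap.opNorm_le_bound _ (norm_nonneg _) fun ψ =>
    ContinuousLinearMap.opNorm_le_bound _ (by positivity) fun w =>
    ContinuousLinearMap.opNorm_le_bound _ (by positivity) fun z => ?_
  rw [adjointCoeff_apply, norm_neg]
  refine (ψ.le_opNorm_of_le (N.le_opNorm₂ z w)).trans (le_of_eq ?_)
  ring

/-- The adjoint of a continuous family of coefficients. -/
abbrev adjointFamily (N : C(Icc (0 : ℝ) T, S →L[ℝ] W →L[ℝ] S)) :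
    C(Icc (0 : ℝ) T, StrongDual ℝ S →L[ℝ] W →L[ℝ] StrongDual ℝ S) :=
  (⟨adjointCoeff, continuous_adjointCoeff⟩ : C(_, _)).comp N

/-- `ψ` solves `ψ(t) = η - ∫₀ᵗ ψ(s) ∘ N(s)(·)(v(s)) ds` on `[0,T]`. -/
def IsAdjoint (N : C(Icc (0 : ℝ) T, S →L[ℝ] W →L[ℝ] S)) (v : Lp W 2 (timeMeasure T))
    (η : StrongDual ℝ S) (ψ : C(Icc (0 : ℝ) T, StrongDual ℝ S)) : Prop :=
  ψ = ContinuousMap.const _ η + volterra hT (adjointFamily N) v ψ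

variable {N : C(Icc (0 : ℝ) T, S →L[ℝ] W →L[ℝ] S)} {v : Lp W 2 (timeMeasure T)}

/-- Existence of solutions of linear Volterra equations. -/
theorem exists_eq_add_volterra [CompleteSpace S] (N : C(Icc (0 : ℝ) T, S →L[ℝ] W →L[ℝ] S))
    (v : Lp W 2 (timeMeasure T)) (g : C(Icc (0 : ℝ) T, S)) :
    ∃! y, y = g + volterra hT N v y := by
  obtain ⟨e, he⟩ := isUnit_one_sub_volterra hT N v
  have h1 (y : C(Icc (0 : ℝ) T, S)) : (e : _ →L[ℝ] _) y = y - volterra hT N v y := by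
    rw [he]; rfl
  have hb := (ContinuousLinearEquiv.ofUnit e).bijective
  obtain ⟨y, hy, huniq⟩ := hb.existsUnique g
  refine ⟨y, ?_, fun z hz => huniq z ?_⟩
  · exact sub_eq_iff_eq_add.1 ((h1 y).symm.trans hy)
  · exact (h1 z).trans (sub_eq_iff_eq_add.2 hz)

theorem intervalIntegrable_volterra {S' : Type*} [NormedAddCommGroup S'] [NormedSpace ℝ S']
    (N : C(Icc (0 : ℝ) T, S →L[ℝ] W →L[ℝ] S'))
    (v : Lp W 2 (timeMeasure T)) (y : C(Icc (0 : ℝ) T, S)) :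
    IntervalIntegrable (fun s => IccExtend hT N s (IccExtend hT y s) (v s)) volume 0 T :=
  intervalIntegrable_apply_control (continuous_extend (hT := hT) (pointwiseApply N y)) v
    ⟨hT, le_rfl⟩

/-- Duality between the adjoint equation and the linearized state equation. -/
theorem IsAdjoint.apply_eq [FiniteDimensional ℝ S] {η : StrongDual ℝ S}
    {ψ : C(Icc (0 : ℝ) T, StrongDual ℝ S)} (hψ : IsAdjoint hT N v η ψ)
    {y : C(Icc (0 : ℝ) T, S)} {y₀ : S} {g : C(Icc (0 : ℝ) T, W →L[ℝ] S)}
    {w : Lp W 2 (timeMeasure T)}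
    (hy : y = ContinuousMap.const _ y₀ + (volterra hT N v y + controlIntegral hT g w)) :
    ψ ⟨T, hT, le_rfl⟩ (y ⟨T, hT, le_rfl⟩) =
      η y₀ + ∫ s in (0 : ℝ)..T, IccExtend hT ψ s (IccExtend hT g s (w s)) := by
  have hmem : T ∈ Icc (0 : ℝ) T := ⟨hT, le_rfl⟩
  have hi1 := intervalIntegrable_volterra hT N v y
  have hi2 := intervalIntegrable_apply_control (continuous_extend (hT := hT) g) w hmem
  have hi3 := intervalIntegrable_volterra hT (adjointFamily N) v ψ
  have hsub {t : ℝ} (ht : t ∈ Icc 0 T) : uIcc 0 t ⊆ uIcc 0 T := by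
    rw [uIcc_of_le ht.1, uIcc_of_le hT]
    exact Icc_subset_Icc_right ht.2
  have h := integral_pairing_of_primitive hT (α := IccExtend hT ψ) (β := IccExtend hT y) (A := η)
    (B := y₀) hi3 (hi1.add hi2) (fun t ht => ?_) (fun t ht => ?_)
  · rw [IccExtend_of_mem _ _ hmem, IccExtend_of_mem _ _ hmem] at h
    rw [← sub_eq_iff_eq_add', ← h]
    -- The term `-ψ(N y v)` from the adjoint equation cancels `ψ(N y v)` from the linearized one,
    -- leaving `ψ(g w)`.
    refine intervalIntegral.integral_congr fun s hs => ?_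
    simp [IccExtend]
  · rw [IccExtend_of_mem _ _ ht]
    exact DFunLike.congr_fun hψ ⟨t, ht⟩
  · rw [IccExtend_of_mem _ _ ht]
    refine (DFunLike.congr_fun hy ⟨t, ht⟩).trans ?_
    rw [ContinuousMap.add_apply, ContinuousMap.const_apply]
    congr 1
    exact (intervalIntegral.integral_add (hi1.mono_set (hsub ht)) (hi2.mono_set (hsub ht))).symm

/-- The adjoint equation can be solved with a prescribed final value. -/
theorem exists_isAdjoint_final [FiniteDimensional ℝ S]
    (N : C(Icc (0 : ℝ) T, S →L[ℝ] W →L[ℝ] S)) (v : Lp W 2 (timeMeasure T))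
    (l : StrongDual ℝ S) :
    ∃ (η : StrongDual ℝ S) (ψ : C(Icc (0 : ℝ) T, StrongDual ℝ S)),
      IsAdjoint hT N v η ψ ∧ ψ ⟨T, hT, le_rfl⟩ = l := by
  have := FiniteDimensional.complete ℝ S
  choose Ψ hΨ huniq using fun η : StrongDual ℝ S =>
    exists_eq_add_volterra hT (adjointFamily N) v (ContinuousMap.const _ η)
  let Λ : StrongDual ℝ S →ₗ[ℝ] StrongDual ℝ S :=
    { toFun := fun η => Ψ η ⟨T, hT, le_rfl⟩
      map_add' := fun η η' => by
        have : Ψ η + Ψ η' = Ψ (η + η') := by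
          refine huniq _ _ (Eq.symm ?_)
          conv_rhs => rw [hΨ η, hΨ η']
          rw [map_add]
          ext t z
          simp only [ContinuousMap.add_apply, ContinuousMap.const_apply, add_apply]
          ring
        rw [← this]; rfl
      map_smul' := fun c η => by
        have : c • Ψ η = Ψ (c • η) := by
          refine huniq _ _ (Eq.symm ?_)
          conv_rhs => rw [hΨ η]
          rw [map_smul, smul_add]
          rfl
        rw [← this]; rfl }
  -- If `ψ(T) = 0`, duality with the homogeneous solution issuing from `y₀` gives `η y₀ = 0`. In
  -- finite dimension, injectivity of initial-to-final transport then gives surjectivity.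
  have hinj : Function.Injective Λ := by
    refine (injective_iff_map_eq_zero Λ).2 fun η hη => ?_
    ext y₀
    obtain ⟨y, hy, -⟩ := exists_eq_add_volterra hT N v (ContinuousMap.const _ y₀)
    have h := IsAdjoint.apply_eq hT (hΨ η) (y := y) (y₀ := y₀) (g := 0) (w := 0)
      (by rwa [(controlIntegral hT (0 : C(Icc (0 : ℝ) T, W →L[ℝ] S))).map_zero, add_zero])
    have h0 : Ψ η ⟨T, hT, le_rfl⟩ = 0 := hη
    simpa [h0, IccExtend] using h.symm
  obtain ⟨η, hη⟩ := (LinearMap.injective_iff_surjective.1 hinj) l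
  exact ⟨η, Ψ η, hΨ η, hη⟩

/-- A Gronwall bound for solutions of the adjoint equation. -/
theorem IsAdjoint.norm_sq_le {η : StrongDual ℝ S}
    {ψ : C(Icc (0 : ℝ) T, StrongDual ℝ S)} (hψ : IsAdjoint hT N v η ψ) {B : ℝ}
    (hB : ‖v‖ * ‖N‖ ≤ B) (t : Icc (0 : ℝ) T) :
    ‖ψ t‖ ^ 2 ≤ 2 * ‖η‖ ^ 2 +
      2 * B ^ 2 * (Real.exp (2 * B ^ 2 * t) * (t * (2 * ‖η‖ ^ 2))) := by
  have hF : Continuous fun s => ‖IccExtend hT ψ s‖ ^ 2 := (continuous_extend ψ).norm.pow 2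
  have hN : ‖adjointFamily N‖ ≤ ‖N‖ :=
    (ContinuousMap.norm_le _ (norm_nonneg _)).2 fun t =>
      (norm_adjointCoeff_le _).trans (N.norm_coe_le_norm t)
  have key (t : Icc (0 : ℝ) T) : ‖ψ t‖ ^ 2 ≤ 2 * ‖η‖ ^ 2 +
      2 * B ^ 2 * ∫ s in (0 : ℝ)..t, ‖IccExtend hT ψ s‖ ^ 2 := by
    have h1 := norm_sq_volterra_apply_le hT (adjointFamily N) v ψ t
    have h2 : ‖ψ t‖ ≤ ‖η‖ + ‖volterra hT (adjointFamily N) v ψ t‖ := by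
      conv_lhs => rw [hψ]
      exact norm_add_le _ _
    have h3 : ‖v‖ * ‖adjointFamily N‖ ≤ B :=
      (mul_le_mul_of_nonneg_left hN (norm_nonneg v)).trans hB
    have h4 : 0 ≤ ∫ s in (0 : ℝ)..t, ‖IccExtend hT ψ s‖ ^ 2 :=
      intervalIntegral.integral_nonneg t.2.1 fun s _ => by positivity
    have h5 : (‖v‖ * ‖adjointFamily N‖) ^ 2 ≤ B ^ 2 := by gcongr
    have h6 := mul_le_mul_of_nonneg_right h5 h4
    have h7 := (pow_le_pow_left₀ (norm_nonneg _) h2 2).trans add_sq_le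
    linarith
  refine (key t).trans (add_le_add_right (mul_le_mul_of_nonneg_left ?_ (by positivity)) _)
  have h := integral_le_of_le_add_integral (T := T) hF (a := fun _ => 2 * ‖η‖ ^ 2)
    continuous_const (K := 2 * B ^ 2) (by positivity) (fun _ => by positivity)
    (fun t ht => by simpa only [IccExtend_of_mem _ _ ht] using key ⟨t, ht⟩) t t.2
  rwa [intervalIntegral.integral_const, smul_eq_mul, sub_zero] at h

end Adjoint

/-! ### Reduction of the affine system to a driftless one; the end-point mapping -/

section AffineSystem

variable {n m : ℕ} (f₀ : State n → State n) (f : Fin m → State n → State n) {T : ℝ} (hT : 0 ≤ T)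

/-- The control space `ℝ × ℝᵐ`, in which an affine system becomes a driftless one. -/
abbrev AugSpace (m : ℕ) : Type := ℝ × EuclideanSpace ℝ (Fin m)

/-- The map `x ↦ ((a, w) ↦ a f₀(x) + ∑ i, w_i f_i(x))`. -/
def affineField (x : State n) : AugSpace m →L[ℝ] State n :=
  (ContinuousLinearMap.fst ℝ ℝ (EuclideanSpace ℝ (Fin m))).smulRight (f₀ x) +
    ∑ i, ((EuclideanSpace.proj i : EuclideanSpace ℝ (Fin m) →L[ℝ] ℝ) ∘L
      ContinuousLinearMap.snd ℝ ℝ (EuclideanSpace ℝ (Fin m))).smulRight (f i x)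

@[simp]
theorem affineField_apply (x : State n) (w : AugSpace m) :
    affineField f₀ f x w = w.1 • f₀ x + ∑ i, w.2 i • f i x := by
  simp [affineField]

variable {f₀ f}

theorem contDiff_affineField {k : WithTop ℕ∞} (hf₀ : ContDiff ℝ k f₀)
    (hf : ∀ i, ContDiff ℝ k (f i)) : ContDiff ℝ k (affineField f₀ f) := by
  unfold affineField
  exact (contDiff_const.smulRight hf₀).add
    (ContDiff.sum fun i _ => contDiff_const.smulRight (hf i))

theorem fderiv_affineField_apply (hf₀ : ContDiff ℝ 1 f₀) (hf : ∀ i, ContDiff ℝ 1 (f i))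
    (x z : State n) (w : AugSpace m) :
    fderiv ℝ (affineField f₀ f) x z w =
      w.1 • fderiv ℝ f₀ x z + ∑ i, w.2 i • fderiv ℝ (f i) x z := by
  have h0 := (hf₀.differentiable (by norm_num) x).hasFDerivAt
  have hi := fun i => ((hf i).differentiable (by norm_num) x).hasFDerivAt
  have h1 : HasFDerivAt (fun x => affineField f₀ f x w)
      (w.1 • fderiv ℝ f₀ x + ∑ i, w.2 i • fderiv ℝ (f i) x) x := by
    simp only [affineField_apply]
    exact (h0.const_smul w.1).add (HasFDerivAt.fun_sum fun i _ => (hi i).const_smul (w.2 i))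
  have h2 : HasFDerivAt (fun x => affineField f₀ f x w) _ x :=
    ((contDiff_affineField hf₀ hf).differentiable (by norm_num) x).hasFDerivAt.clm_apply
      (hasFDerivAt_const w x)
  have h3 := DFunLike.congr_fun (h2.unique h1) z
  simpa using h3

/-- The linear part of the augmentation of controls. -/
def augmentL (m : ℕ) (T : ℝ) : Control m T →L[ℝ] Lp (AugSpace m) 2 (timeMeasure T) :=
  (ContinuousLinearMap.inr ℝ ℝ (EuclideanSpace ℝ (Fin m))).compLpL 2 (timeMeasure T)

/-- The augmented control `(1, u)`. -/
def augment (u : Control m T) : Lp (AugSpace m) 2 (timeMeasure T) :=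
  Lp.const 2 (timeMeasure T) ((1, 0) : AugSpace m) + augmentL m T u

theorem coeFn_augmentL (u : Control m T) :
    augmentL m T u =ᵐ[timeMeasure T] fun s => ((0, u s) : AugSpace m) :=
  ContinuousLinearMap.coeFn_compLpL _ u

theorem coeFn_augment (u : Control m T) :
    augment u =ᵐ[timeMeasure T] fun s => ((1, u s) : AugSpace m) := by
  filter_upwards [Lp.coeFn_add (Lp.const 2 (timeMeasure T) ((1, 0) : AugSpace m)) (augmentL m T u),
    Lp.coeFn_const (p := 2) (μ := timeMeasure T) ((1, 0) : AugSpace m),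
    coeFn_augmentL u] with s h1 h2 h3
  rw [augment, h1, Pi.add_apply, h2, h3]
  simp

theorem continuous_augment : Continuous (augment : Control m T → _) :=
  continuous_const.add (augmentL m T).continuous

theorem hasStrictFDerivAt_augment (u : Control m T) :
    HasStrictFDerivAt augment (augmentL m T) u :=
  (augmentL m T).hasStrictFDerivAt.const_add _

variable (hc : Continuous (affineField f₀ f))

theorem IsTrajectory.isSolution {u : Control m T} {x : ℝ → State n}
    (h : IsTrajectory f₀ f T u x) :
    IsSolution hT hc (augment u) ⟨(Icc 0 T).domRestrict x, h.1.domRestrict⟩ := by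
  ext1 t
  rw [controlIntegral_apply]
  refine Eq.trans (intervalIntegral.integral_congr_ae_restrict ?_) (h.2 t t.2).symm
  rw [uIoc_of_le t.2.1]
  filter_upwards [ae_mono (restrict_Ioc_le t.2) (coeFn_augment u),
    ae_restrict_mem measurableSet_Ioc] with s hs hst
  rw [hs, IccExtend_of_mem _ _ ⟨hst.1.le, hst.2.trans t.2.2⟩]
  simp only [ContinuousMap.comp_apply, ContinuousMap.coe_mk, affineField_apply, one_smul,
    domRestrict_apply]

theorem IsSolution.apply_eq {u : Control m T} {X : C(Icc (0 : ℝ) T, State n)}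
    (h : IsSolution hT hc (augment u) X) {t : ℝ} (ht : t ∈ Icc 0 T) :
    X ⟨t, ht⟩ = ∫ s in (0 : ℝ)..t,
      (f₀ (IccExtend hT X s) + ∑ i, u s i • f i (IccExtend hT X s)) := by
  have h1 := DFunLike.congr_fun h ⟨t, ht⟩
  rw [← h1, controlIntegral_apply]
  refine intervalIntegral.integral_congr_ae_restrict ?_
  rw [uIoc_of_le ht.1]
  filter_upwards [ae_mono (restrict_Ioc_le ht) (coeFn_augment u)] with s hs
  rw [hs]
  simp [IccExtend]

theorem IsSolution.isTrajectory {u : Control m T} {X : C(Icc (0 : ℝ) T, State n)}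
    (h : IsSolution hT hc (augment u) X) : IsTrajectory f₀ f T u (IccExtend hT X) := by
  refine ⟨(continuous_extend X).continuousOn, fun t ht => ?_⟩
  rw [IccExtend_of_mem _ _ ht]
  exact h.apply_eq hT hc ht

variable {hT} (hf₀ : ContDiff ℝ 1 f₀) (hf : ∀ i, ContDiff ℝ 1 (f i))

theorem exists_isSolution {u : Control m T} (hu : u ∈ admissible f₀ f T) :
    ∃ X, IsSolution hT hc (augment u) X :=
  let ⟨_, hx⟩ := hu
  ⟨_, hx.isSolution hT hc⟩

theorem IsSolution.mem_admissible {u : Control m T} {X : C(Icc (0 : ℝ) T, State n)}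
    (h : IsSolution hT hc (augment u) X) : u ∈ admissible f₀ f T :=
  ⟨_, h.isTrajectory hT hc⟩

/-- `endpoint` selects a trajectory by choice; uniqueness of solutions identifies it with `X`. -/
theorem IsSolution.endpoint_eq {u : Control m T} {X : C(Icc (0 : ℝ) T, State n)}
    (h : IsSolution hT (contDiff_affineField hf₀ hf).continuous (augment u) X) :
    endpoint f₀ f T u = X ⟨T, hT, le_rfl⟩ := by
  have hu : ∃ x, IsTrajectory f₀ f T u x := h.mem_admissible
  rw [endpoint, dif_pos hu]
  have h1 := hu.choose_spec.isSolution hT (contDiff_affineField hf₀ hf).continuous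
  rw [← h.eq hT (contDiff_affineField hf₀ hf) h1]
  rfl

/-- The trajectory depends continuously on the control, locally. -/
theorem IsSolution.exists_local {u : Control m T} {X : C(Icc (0 : ℝ) T, State n)}
    (h : IsSolution hT (contDiff_affineField hf₀ hf).continuous (augment u) X) :
    ∃ φ : Control m T → C(Icc (0 : ℝ) T, State n), φ u = X ∧ ContinuousAt φ u ∧
      ∀ᶠ w in 𝓝 u, IsSolution hT (contDiff_affineField hf₀ hf).continuous (augment w) (φ w) := by
  obtain ⟨φ, φ', h1, h2, h3, -⟩ := h.exists_implicit hT (contDiff_affineField hf₀ hf)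
  exact ⟨φ ∘ augment, h1, h3.continuousAt.comp continuous_augment.continuousAt,
    continuous_augment.continuousAt.eventually h2⟩

/-- The end-point mapping is strictly differentiable on its domain, and its derivative is given
by the linearized system. -/
theorem IsSolution.hasStrictFDerivAt_endpoint {u : Control m T}
    {X : C(Icc (0 : ℝ) T, State n)}
    (h : IsSolution hT (contDiff_affineField hf₀ hf).continuous (augment u) X) :
    HasStrictFDerivAt (endpoint f₀ f T) (dEndpoint f₀ f T u) u ∧
      ∀ w, ∃ y : C(Icc (0 : ℝ) T, State n),
        y = volterra hT (derivAlong (contDiff_affineField hf₀ hf) X) (augment u) y +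
          controlIntegral hT (alongCurve (contDiff_affineField hf₀ hf).continuous X)
            (augmentL m T w) ∧
        dEndpoint f₀ f T u w = y ⟨T, hT, le_rfl⟩ := by
  obtain ⟨φ, φ', h1, h2, h3, h4⟩ := h.exists_implicit hT (contDiff_affineField hf₀ hf)
  have hE : HasStrictFDerivAt (endpoint f₀ f T)
      (ContinuousMap.evalCLM ℝ (⟨T, hT, le_rfl⟩ : Icc (0 : ℝ) T) ∘L (φ' ∘L augmentL m T)) u := by
    have h5 := (ContinuousMap.evalCLM ℝ (⟨T, hT, le_rfl⟩ : Icc (0 : ℝ) T) :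
      C(Icc (0 : ℝ) T, State n) →L[ℝ] State n).hasStrictFDerivAt.comp u
      (h3.comp u (hasStrictFDerivAt_augment u))
    refine h5.congr_of_eventuallyEq ?_
    filter_upwards [continuous_augment.continuousAt.eventually h2] with w hw
    exact (hw.endpoint_eq hf₀ hf).symm
  have hd : dEndpoint f₀ f T u = _ := hE.hasFDerivAt.fderiv
  refine ⟨hd ▸ hE, fun w => ⟨φ' (augmentL m T w), h4 _, ?_⟩⟩
  rw [hd]
  rfl

end AffineSystem

/-! ### Adjoint covectors and normal extremals -/

section Extremals

variable {n m : ℕ} {f₀ : State n → State n} {f : Fin m → State n → State n} {T : ℝ} {hT : 0 ≤ T}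

theorem continuous_normalControl (hf : ∀ i, Continuous (f i)) (X : C(Icc (0 : ℝ) T, State n))
    (P : C(Icc (0 : ℝ) T, Covector n)) :
    Continuous (normalControl f (IccExtend hT X) (IccExtend hT P)) :=
  (PiLp.continuous_toLp 2 _).comp (continuous_pi fun i =>
    (continuous_extend P).clm_apply ((hf i).comp (continuous_extend X)))

theorem memLp_of_continuous {E : Type*} [NormedAddCommGroup E] {g : ℝ → E} (hg : Continuous g)
    [SecondCountableTopology E] : MemLp g 2 (timeMeasure T) := by
  obtain ⟨B, hB⟩ := isCompact_Icc.exists_bound_of_continuousOn (s := Icc (0 : ℝ) T)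
    hg.continuousOn
  exact MemLp.of_bound hg.aestronglyMeasurable B
    ((ae_restrict_iff' measurableSet_Icc).2 (.of_forall hB))

/-- The switching function `t ↦ (⟨P(t), f_i(X(t))⟩)_i`, as a control. -/
def switching (hT : 0 ≤ T) (hf : ∀ i, Continuous (f i)) (X : C(Icc (0 : ℝ) T, State n))
    (P : C(Icc (0 : ℝ) T, Covector n)) : Control m T :=
  (memLp_of_continuous (continuous_normalControl (hT := hT) hf X P)).toLp

theorem coeFn_switching (hf : ∀ i, Continuous (f i)) (X : C(Icc (0 : ℝ) T, State n))
    (P : C(Icc (0 : ℝ) T, Covector n)) :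
    switching hT hf X P =ᵐ[timeMeasure T] normalControl f (IccExtend hT X) (IccExtend hT P) :=
  MemLp.coeFn_toLp _

variable (hf₀ : ContDiff ℝ 1 f₀) (hf : ∀ i, ContDiff ℝ 1 (f i))

/-- Every covector at the end-point is transported by the adjoint equation, and its pull-back
by the derivative of the end-point mapping is the switching function. -/
theorem IsSolution.exists_adjoint {u : Control m T} {X : C(Icc (0 : ℝ) T, State n)}
    (h : IsSolution hT (contDiff_affineField hf₀ hf).continuous (augment u) X)
    (l : Covector n) :
    ∃ (η : Covector n) (P : C(Icc (0 : ℝ) T, Covector n)),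
      IsAdjoint hT (derivAlong (contDiff_affineField hf₀ hf) X) (augment u) η P ∧
      P ⟨T, hT, le_rfl⟩ = l ∧
      ∀ w, l (dEndpoint f₀ f T u w) = ⟪switching hT (fun i => (hf i).continuous) X P, w⟫ := by
  obtain ⟨η, P, hP, hPT⟩ := exists_isAdjoint_final hT
    (derivAlong (contDiff_affineField hf₀ hf) X) (augment u) l
  refine ⟨η, P, hP, hPT, fun w => ?_⟩
  obtain ⟨y, hy, hw⟩ := (h.hasStrictFDerivAt_endpoint hf₀ hf).2 w
  have h0 : (ContinuousMap.const (Icc (0 : ℝ) T) (0 : State n)) = 0 := rfl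
  have h1 := hP.apply_eq hT (y₀ := 0) (by rw [h0, zero_add]; exact hy)
  rw [hw, ← hPT, h1, map_zero, zero_add, L2.inner_def, intervalIntegral.integral_of_le hT,
    integral_Icc_eq_integral_Ioc]
  refine integral_congr_ae ?_
  have hle := restrict_Ioc_le (T := T) (t := T) ⟨hT, le_rfl⟩
  filter_upwards [ae_mono hle (coeFn_augmentL w),
    ae_mono hle (coeFn_switching (hT := hT) (fun i => (hf i).continuous) X P)] with s h2 h3
  rw [h2, h3, PiLp.inner_apply]
  simp [IccExtend, normalControl]

/-- The control agrees almost everywhere with a continuous function, so both integral equations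
acquire continuous integrands and can be differentiated at every time. -/
theorem IsSolution.isNormalExtremal {u : Control m T} {X : C(Icc (0 : ℝ) T, State n)}
    (h : IsSolution hT (contDiff_affineField hf₀ hf).continuous (augment u) X)
    {η : Covector n} {P : C(Icc (0 : ℝ) T, Covector n)}
    (hP : IsAdjoint hT (derivAlong (contDiff_affineField hf₀ hf) X) (augment u) η P)
    (hu : u = switching hT (fun i => (hf i).continuous) X P) :
    IsNormalExtremal f₀ f T η (IccExtend hT X) (IccExtend hT P) := by
  set x := IccExtend hT X with hx
  set p := IccExtend hT P with hp
  have hxc : Continuous x := continuous_extend X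
  have hpc : Continuous p := continuous_extend P
  have h0 : (0 : ℝ) ∈ Icc 0 T := ⟨le_rfl, hT⟩
  have hae : u =ᵐ[timeMeasure T] normalControl f x p := by
    conv_lhs => rw [hu]
    exact coeFn_switching _ X P
  have hfc := fun i => (hf i).continuous
  have hx' : ∀ t ∈ Icc 0 T, x t = ∫ s in (0 : ℝ)..t,
      (f₀ (x s) + ∑ i, p s (f i (x s)) • f i (x s)) := fun t ht => by
    rw [hx, IccExtend_of_mem _ _ ht, h.apply_eq hT _ ht]
    refine intervalIntegral.integral_congr_ae_restrict ?_
    rw [uIoc_of_le ht.1]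
    filter_upwards [ae_mono (restrict_Ioc_le ht) hae] with s hs
    rw [hs]
    rfl
  have hp' : ∀ t ∈ Icc 0 T, p t = η + ∫ s in (0 : ℝ)..t,
      (-(p s ∘L (fderiv ℝ f₀ (x s) + ∑ i, p s (f i (x s)) • fderiv ℝ (f i) (x s)))) :=
      fun t ht => by
    rw [hp, IccExtend_of_mem _ _ ht]
    refine (DFunLike.congr_fun hP ⟨t, ht⟩).trans ?_
    rw [ContinuousMap.add_apply, ContinuousMap.const_apply, volterra_apply]
    congr 1
    refine intervalIntegral.integral_congr_ae_restrict ?_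
    rw [uIoc_of_le ht.1]
    filter_upwards [ae_mono (restrict_Ioc_le ht) hae,
      ae_mono (restrict_Ioc_le ht) (coeFn_augment u)] with s hs hs'
    rw [hs', hs]
    ext z
    change -(p s) (fderiv ℝ (affineField f₀ f) (x s) z (1, normalControl f x p s)) = _
    rw [fderiv_affineField_apply hf₀ hf]
    simp [normalControl, hp]
  refine ⟨?_, ?_, fun t ht => ⟨?_, ?_⟩⟩
  · rw [hx' 0 h0, intervalIntegral.integral_same]
  · rw [hp' 0 h0, intervalIntegral.integral_same, add_zero]
  · have hc : Continuous fun s => f₀ (x s) + ∑ i, p s (f i (x s)) • f i (x s) := by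
      have := hf₀.continuous
      fun_prop
    exact (hc.integral_hasStrictDerivAt 0 t).hasDerivAt.hasDerivWithinAt.congr hx' (hx' t ht)
  · have hc : Continuous fun s =>
        -(p s ∘L (fderiv ℝ f₀ (x s) + ∑ i, p s (f i (x s)) • fderiv ℝ (f i) (x s))) := by
      have h1 := hf₀.continuous_fderiv (by norm_num)
      have h2 := fun i => (hf i).continuous_fderiv (by norm_num)
      fun_prop
    exact ((hc.integral_hasStrictDerivAt 0 t).hasDerivAt.const_add η).hasDerivWithinAt.congr hp'
      (hp' t ht)

/-- The normal Hamiltonian vector field. -/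
def hamiltonianField (f₀ : State n → State n) (f : Fin m → State n → State n)
    (z : State n × Covector n) : State n × Covector n :=
  (f₀ z.1 + ∑ i, z.2 (f i z.1) • f i z.1,
    -(z.2 ∘L (fderiv ℝ f₀ z.1 + ∑ i, z.2 (f i z.1) • fderiv ℝ (f i) z.1)))

/-- The covector equation contains derivatives of the fields, hence the `C²` requirement. It makes
the Hamiltonian field locally Lipschitz and its extremals unique. -/
theorem contDiff_hamiltonianField (hf₀ : ContDiff ℝ 2 f₀) (hf : ∀ i, ContDiff ℝ 2 (f i)) :
    ContDiff ℝ 1 (hamiltonianField f₀ f) := by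
  have h0 : ContDiff ℝ 1 f₀ := hf₀.of_le (by norm_num)
  have hi := fun i => (hf i).of_le (show (1 : WithTop ℕ∞) ≤ 2 by norm_num)
  have h0' : ContDiff ℝ 1 (fderiv ℝ f₀) := hf₀.fderiv_right (by norm_num)
  have hi' : ∀ i, ContDiff ℝ 1 (fderiv ℝ (f i)) := fun i => (hf i).fderiv_right (by norm_num)
  have hp (i) : ContDiff ℝ 1 fun z : State n × Covector n => z.2 (f i z.1) :=
    contDiff_snd.clm_apply ((hi i).comp contDiff_fst)
  refine ContDiff.prodMk ((h0.comp contDiff_fst).add (ContDiff.sum fun i _ =>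
    (hp i).smul ((hi i).comp contDiff_fst))) (ContDiff.neg (contDiff_snd.clm_comp
      ((h0'.comp contDiff_fst).add (ContDiff.sum fun i _ =>
        (hp i).smul ((hi' i).comp contDiff_fst)))))

/-- Normal extremals are determined on `[0,T]` by the initial covector. -/
theorem IsNormalExtremal.eqOn (hf₀ : ContDiff ℝ 2 f₀) (hf : ∀ i, ContDiff ℝ 2 (f i))
    {η : Covector n} {x x' : ℝ → State n} {p p' : ℝ → Covector n}
    (h : IsNormalExtremal f₀ f T η x p) (h' : IsNormalExtremal f₀ f T η x' p') :
    EqOn (fun t => (x t, p t)) (fun t => (x' t, p' t)) (Icc 0 T) := by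
  have hd {x : ℝ → State n} {p : ℝ → Covector n} (h : IsNormalExtremal f₀ f T η x p) :
      ∀ t ∈ Icc 0 T, HasDerivWithinAt (fun t => (x t, p t)) (hamiltonianField f₀ f (x t, p t))
        (Icc 0 T) t := fun t ht => (h.2.2 t ht).1.prodMk (h.2.2 t ht).2
  have hcont {x : ℝ → State n} {p : ℝ → Covector n} (h : IsNormalExtremal f₀ f T η x p) :
      ContinuousOn (fun t => (x t, p t)) (Icc 0 T) := fun t ht => (hd h t ht).continuousWithinAt
  have hright {x : ℝ → State n} {p : ℝ → Covector n} (h : IsNormalExtremal f₀ f T η x p) :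
      ∀ t ∈ Ico 0 T, HasDerivWithinAt (fun t => (x t, p t)) (hamiltonianField f₀ f (x t, p t))
        (Ici t) t := fun t ht =>
    (hd h t ⟨ht.1, ht.2.le⟩).mono_of_mem_nhdsWithin
      (mem_of_superset (Icc_mem_nhdsGE ht.2) (Icc_subset_Icc_left ht.1))
  obtain ⟨R, hR⟩ := isCompact_Icc.exists_bound_of_continuousOn (hcont h)
  obtain ⟨R', hR'⟩ := isCompact_Icc.exists_bound_of_continuousOn (hcont h')
  obtain ⟨L, hL, hLip⟩ := exists_lipschitz_on_ball (contDiff_hamiltonianField hf₀ hf) (max R R')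
  refine ODE_solution_unique_of_mem_Icc_right (v := fun _ => hamiltonianField f₀ f)
    (K := ⟨L, hL⟩) (s := fun _ => Metric.closedBall 0 (max R R'))
    (fun t _ => LipschitzOnWith.of_dist_le_mul fun a ha b hb => ?_) (hcont h) (hright h)
    (fun t ht => ?_) (hcont h') (hright h') (fun t ht => ?_) ?_
  · rw [dist_eq_norm, dist_eq_norm]
    exact hLip a b (by simpa using ha) (by simpa using hb)
  · exact mem_closedBall_zero_iff.2 ((hR t ⟨ht.1, ht.2.le⟩).trans (le_max_left _ _))
  · exact mem_closedBall_zero_iff.2 ((hR' t ⟨ht.1, ht.2.le⟩).trans (le_max_right _ _))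
  · simp only [h.1, h.2.1, h'.1, h'.2.1]

/-- `normalMap` uses a chosen extremal from `η`, which uniqueness identifies with the given one. -/
theorem IsNormalExtremal.expMap_eq (hf₀ : ContDiff ℝ 2 f₀) (hf : ∀ i, ContDiff ℝ 2 (f i))
    {η : Covector n} {X : C(Icc (0 : ℝ) T, State n)} {P : C(Icc (0 : ℝ) T, Covector n)}
    (h : IsNormalExtremal f₀ f T η (IccExtend hT X) (IccExtend hT P))
    (hη : η ∈ normalDomain f₀ f T) :
    expMap f₀ f T (fun i => (hf i).continuous) ⟨η, hη⟩ =
      endpoint f₀ f T (switching hT (fun i => (hf i).continuous) X P) := by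
  unfold expMap
  congr 1
  unfold normalMap switching
  refine (MemLp.toLp_eq_toLp_iff _ _).2 ?_
  have h' := hη.choose_spec.choose_spec
  have he := h'.eqOn hf₀ hf h
  refine (ae_restrict_iff' measurableSet_Icc).2 (.of_forall fun t ht => ?_)
  have h1 := he ht
  simp only [Prod.mk.injEq] at h1
  unfold normalControl
  simp only [h1.1, h1.2]

end Extremals

/-! ### Weak convergence and penalized minimization in Hilbert space -/

section Hilbert

variable {H G : Type*} [NormedAddCommGroup H] [InnerProductSpace ℝ H]
  [NormedAddCommGroup G] [InnerProductSpace ℝ G]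

/-- Weak convergence of sequences. -/
def WeakTendsto (w : ℕ → H) (v : H) : Prop :=
  ∀ ℓ : H →L[ℝ] ℝ, Tendsto (fun j => ℓ (w j)) atTop (𝓝 (ℓ v))

theorem exists_weakTendsto_subseq [CompleteSpace H] [TopologicalSpace.SeparableSpace H]
    {w : ℕ → H} {R : ℝ} (hw : ∀ j, ‖w j‖ ≤ R) :
    ∃ v, ∃ θ : ℕ → ℕ, StrictMono θ ∧ WeakTendsto (w ∘ θ) v := by
  let W : ℕ → WeakDual ℝ H := fun j => StrongDual.toWeakDual (InnerProductSpace.toDual ℝ H (w j))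
  have hmem : ∀ j, W j ∈
      WeakDual.toStrongDual ⁻¹' Metric.closedBall (0 : StrongDual ℝ H) R := fun j => by
    rw [mem_preimage, mem_closedBall_zero_iff]
    exact ((InnerProductSpace.toDual ℝ H).norm_map (w j)).trans_le (hw j)
  obtain ⟨ℓ, -, θ, hθ, hlim⟩ := WeakDual.isSeqCompact_closedBall ℝ H 0 R hmem
  refine ⟨(InnerProductSpace.toDual ℝ H).symm (WeakDual.toStrongDual ℓ), θ, hθ, fun ℓ' => ?_⟩
  obtain ⟨z, rfl⟩ := (InnerProductSpace.toDual ℝ H).surjective ℓ'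
  have h := ((WeakDual.eval_continuous z).tendsto ℓ).comp hlim
  simp only [InnerProductSpace.toDual_apply_apply]
  simp_rw [real_inner_comm _ z, InnerProductSpace.toDual_symm_apply]
  exact h

/-- Weak lower semicontinuity of the norm, by pairing with `v` itself. -/
theorem WeakTendsto.norm_le {w : ℕ → H} {v : H} (h : WeakTendsto w v) {c : ℕ → ℝ} {C : ℝ}
    (hc : Tendsto c atTop (𝓝 C)) (hw : ∀ j, ‖w j‖ ≤ c j) : ‖v‖ ≤ C := by
  have h1 : ‖v‖ * ‖v‖ ≤ ‖v‖ * C := by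
    rw [← real_inner_self_eq_norm_mul_norm]
    exact le_of_tendsto_of_tendsto' (h (innerSL ℝ v)) (hc.const_mul ‖v‖) fun j =>
      (real_inner_le_norm v (w j)).trans (by gcongr; exact hw j)
  rcases (norm_nonneg v).eq_or_lt' with h0 | h0
  · rw [h0]
    exact ge_of_tendsto' hc fun j => (norm_nonneg _).trans (hw j)
  · exact le_of_mul_le_mul_left h1 h0

theorem WeakTendsto.sub_const {w : ℕ → H} {v : H} (h : WeakTendsto w v) (u : H) :
    WeakTendsto (fun j => w j - u) (v - u) := fun ℓ => by
  simpa using (h ℓ).sub_const (ℓ u)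

theorem WeakTendsto.mem_closedBall {w : ℕ → H} {v u : H} {δ : ℝ} (h : WeakTendsto w v)
    (hw : ∀ j, w j ∈ Metric.closedBall u δ) : v ∈ Metric.closedBall u δ := by
  rw [mem_closedBall_iff_norm]
  exact (h.sub_const u).norm_le tendsto_const_nhds fun j => mem_closedBall_iff_norm.1 (hw j)

/-- The norm bound gives `‖w j - v‖² ≤ 2(‖v‖² - ⟪v, w j⟫)`, and the right side tends to zero. -/
theorem WeakTendsto.tendsto_of_norm_le {w : ℕ → H} {v : H} (h : WeakTendsto w v)
    (hw : ∀ j, ‖w j‖ ≤ ‖v‖) : Tendsto w atTop (𝓝 v) := by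
  have h1 : Tendsto (fun j => 2 * (‖v‖ ^ 2 - ⟪v, w j⟫)) atTop (𝓝 0) := by
    have := ((h (innerSL ℝ v)).const_sub (‖v‖ ^ 2)).const_mul 2
    simpa [real_inner_self_eq_norm_sq] using this
  have h2 : Tendsto (fun j => ‖w j - v‖ ^ 2) atTop (𝓝 0) := by
    refine squeeze_zero (fun _ => by positivity) (fun j => ?_) h1
    have h3 := pow_le_pow_left₀ (norm_nonneg _) (hw j) 2
    rw [norm_sub_sq_real, real_inner_comm]
    linarith
  refine tendsto_sub_nhds_zero_iff.1 (tendsto_zero_iff_norm_tendsto_zero.2 ?_)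
  simpa [Real.sqrt_sq] using h2.sqrt

/-- The penalized functional. -/
def penalized (F : H → G) (A : G) (k : ℕ) (v : H) : ℝ := ‖v‖ ^ 2 + k * ‖F v - A‖ ^ 2

theorem norm_le_of_mem_closedBall {v u : H} {δ : ℝ} (hv : v ∈ Metric.closedBall u δ) :
    ‖v‖ ≤ ‖u‖ + δ := by
  have := norm_le_norm_add_norm_sub' v u
  have := mem_closedBall_iff_norm.1 hv
  linarith

/-- The direct method: along a weakly convergent minimizing sequence the penalty converges, the norm
is lower semicontinuous, and closed balls are weakly closed. -/
theorem exists_isMinOn_penalized [CompleteSpace H] [TopologicalSpace.SeparableSpace H]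
    {F : H → G} {u : H} {δ : ℝ} (hδ : 0 ≤ δ)
    (hF : ∀ (w : ℕ → H) (v : H), (∀ j, w j ∈ Metric.closedBall u δ) →
      WeakTendsto w v → Tendsto (fun j => F (w j)) atTop (𝓝 (F v))) (A : G) (k : ℕ) :
    ∃ v ∈ Metric.closedBall u δ, IsMinOn (penalized F A k) (Metric.closedBall u δ) v := by
  set J := penalized F A k
  have hJ0 (v : H) : 0 ≤ J v := by
    change 0 ≤ ‖v‖ ^ 2 + k * ‖F v - A‖ ^ 2
    positivity
  have hbdd : BddBelow (J '' Metric.closedBall u δ) := ⟨0, by rintro _ ⟨v, -, rfl⟩; exact hJ0 v⟩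
  have hne : (J '' Metric.closedBall u δ).Nonempty :=
    ⟨_, u, Metric.mem_closedBall_self hδ, rfl⟩
  obtain ⟨a, -, ha, hmem⟩ := exists_seq_tendsto_sInf hne hbdd
  choose w hw hwa using hmem
  obtain ⟨v, θ, hθ, hweak⟩ :=
    exists_weakTendsto_subseq fun j => norm_le_of_mem_closedBall (hw j)
  have hv := hweak.mem_closedBall fun j => hw (θ j)
  refine ⟨v, hv, fun z hz => ?_⟩
  set I := sInf (J '' Metric.closedBall u δ)
  have hFv := hF _ v (fun j => hw (θ j)) hweak
  have hlim : Tendsto (fun j => √(J (w (θ j)) - k * ‖F (w (θ j)) - A‖ ^ 2)) atTop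
      (𝓝 √(I - k * ‖F v - A‖ ^ 2)) := by
    refine Tendsto.sqrt (Tendsto.sub ?_ (((hFv.sub_const A).norm.pow 2).const_mul _))
    simp_rw [hwa]
    exact ha.comp hθ.tendsto_atTop
  have hle := hweak.norm_le hlim fun j => by simp [J, penalized, Real.sqrt_sq]
  have hI : 0 ≤ I - k * ‖F v - A‖ ^ 2 := by
    refine ge_of_tendsto' (f := fun j => J (w (θ j)) - k * ‖F (w (θ j)) - A‖ ^ 2) (x := atTop)
      (Tendsto.sub ?_ (((hFv.sub_const A).norm.pow 2).const_mul _)) fun j => ?_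
    · simp_rw [hwa]
      exact ha.comp hθ.tendsto_atTop
    · simp [J, penalized]
  have h1 := pow_le_pow_left₀ (norm_nonneg v) hle 2
  rw [Real.sq_sqrt hI] at h1
  have h2 : I ≤ J z := csInf_le hbdd ⟨z, hz, rfl⟩
  change ‖v‖ ^ 2 + k * ‖F v - A‖ ^ 2 ≤ J z
  linarith

/-- If `u` is the only element of least norm in a fibre of `F` inside a ball, then minimizers of
the penalized functionals in the ball converge to `u`. -/
theorem exists_tendsto_isMinOn_penalized [CompleteSpace H] [TopologicalSpace.SeparableSpace H]
    {F : H → G} {u : H} {δ : ℝ} (hδ : 0 ≤ δ)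
    (hF : ∀ (w : ℕ → H) (v : H), (∀ j, w j ∈ Metric.closedBall u δ) →
      WeakTendsto w v → Tendsto (fun j => F (w j)) atTop (𝓝 (F v)))
    (huniq : ∀ v ∈ Metric.closedBall u δ, F v = F u → ‖v‖ ≤ ‖u‖ → v = u) :
    ∃ v : ℕ → H, Tendsto v atTop (𝓝 u) ∧
      ∀ k, IsMinOn (penalized F (F u) k) (Metric.closedBall u δ) (v k) := by
  choose v hv hmin using exists_isMinOn_penalized hδ hF (F u)
  refine ⟨v, ?_, hmin⟩
  -- Comparison with `u`, whose penalty vanishes. It yields both `‖v k‖ ≤ ‖u‖` and a penalty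
  -- distance of order `1/k`.
  have hJ (k : ℕ) : ‖v k‖ ^ 2 + k * ‖F (v k) - F u‖ ^ 2 ≤ ‖u‖ ^ 2 := by
    have := hmin k (Metric.mem_closedBall_self hδ)
    simpa [penalized] using this
  have hnorm (k : ℕ) : ‖v k‖ ≤ ‖u‖ := by
    refine le_of_sq_le_sq ?_ (norm_nonneg u)
    have : 0 ≤ (k : ℝ) * ‖F (v k) - F u‖ ^ 2 := by positivity
    linarith [hJ k]
  have hFlim : Tendsto (fun k => F (v k)) atTop (𝓝 (F u)) := by
    have h1 : Tendsto (fun k => ‖F (v k) - F u‖ ^ 2) atTop (𝓝 0) := by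
      refine squeeze_zero' (.of_forall fun _ => by positivity) ?_
        (tendsto_const_div_atTop_nhds_zero_nat (‖u‖ ^ 2))
      filter_upwards [eventually_gt_atTop 0] with k hk
      have hk' : (0 : ℝ) < k := by exact_mod_cast hk
      rw [le_div_iff₀ hk']
      have : 0 ≤ ‖v k‖ ^ 2 := by positivity
      linarith [hJ k]
    refine tendsto_sub_nhds_zero_iff.1 (tendsto_zero_iff_norm_tendsto_zero.2 ?_)
    simpa [Real.sqrt_sq] using h1.sqrt
  refine tendsto_of_subseq_tendsto fun σ hσ => ?_
  obtain ⟨z, θ, hθ, hweak⟩ := exists_weakTendsto_subseq fun j => hnorm (σ j)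
  have hz := hweak.mem_closedBall fun j => hv (σ (θ j))
  have hzF : F z = F u := tendsto_nhds_unique (hF _ z (fun j => hv (σ (θ j))) hweak)
    (hFlim.comp (hσ.comp hθ.tendsto_atTop))
  -- A weak limit lies in the fibre and has norm at most `‖u‖`, so it is `u`; the same norm bound
  -- then makes the convergence strong.
  have hzu := huniq z hz hzF (hweak.norm_le tendsto_const_nhds fun j => hnorm (σ (θ j)))
  subst hzu
  exact ⟨θ, hweak.tendsto_of_norm_le fun j => hnorm _⟩

/-- The derivative vanishes: `⟪v, w⟫ + k⟪F v - A, F' w⟫ = 0`. The multiplier is thus `-k⟪F v - A,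
·⟫`. -/
theorem exists_multiplier_of_isLocalMin_penalized [CompleteSpace H] {F : H → G}
    {F' : H →L[ℝ] G} {v : H} {A : G} {k : ℕ} (hmin : IsLocalMin (penalized F A k) v) (hF : HasFDerivAt F F' v) :
    ∃ l : StrongDual ℝ G, ∀ w, l (F' w) = ⟪v, w⟫ := by
  have h1 : HasFDerivAt (penalized F A k) _ v :=
    (hasFDerivAt_id v).norm_sq.add ((hF.sub_const A).norm_sq.const_mul (k : ℝ))
  have h2 := hmin.hasFDerivAt_eq_zero h1
  refine ⟨-((k : ℝ) • innerSL ℝ (F v - A)), fun w => ?_⟩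
  have h3 := DFunLike.congr_fun h2 w
  simp at h3 ⊢
  linarith

end Hilbert

/-- By strict differentiability `f - f'` is `ε/2`-Lipschitz near `x`, which bounds its derivative `g
y - f'` there. -/
theorem tendsto_fderiv_of_hasStrictFDerivAt {E F : Type*} [NormedAddCommGroup E]
    [NormedSpace ℝ E] [NormedAddCommGroup F] [NormedSpace ℝ F] {f : E → F} {x : E}
    {f' : E →L[ℝ] F} (hf : HasStrictFDerivAt f f' x) {g : E → E →L[ℝ] F}
    (hg : ∀ᶠ y in 𝓝 x, HasFDerivAt f (g y) y) : Tendsto g (𝓝 x) (𝓝 f') := by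
  rw [Metric.tendsto_nhds]
  intro ε hε
  obtain ⟨s, hs, hc⟩ := hf.approximates_deriv_on_nhds (c := (ε / 2).toNNReal)
    (Or.inr (Real.toNNReal_pos.2 (half_pos hε)))
  filter_upwards [hg, eventually_mem_nhds_iff.2 hs] with y hy hys
  have hl : LipschitzOnWith (ε / 2).toNNReal (fun z => f z - f' z) s :=
    lipschitzOnWith_iff_restrict.2 hc.lipschitz_sub
  have := (hy.sub f'.hasFDerivAt).le_of_lipschitzOn hys hl
  rw [Real.coe_toNNReal _ (half_pos hε).le] at this
  rw [dist_eq_norm]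
  exact this.trans_lt (half_lt_self hε)

/-! ### Normal and abnormal controls; failure of properness -/

section Main

variable {n m : ℕ} {f₀ : State n → State n} {f : Fin m → State n → State n} {T : ℝ} {hT : 0 ≤ T}

theorem cost_eq_norm_sq (hT : 0 ≤ T) (u : Control m T) : cost T u = ‖u‖ ^ 2 := by
  rw [norm_sq_eq_integral, cost, intervalIntegral.integral_of_le hT, integral_Icc_eq_integral_Ioc]
  refine integral_congr_ae (.of_forall fun t => ?_)
  simp [EuclideanSpace.norm_sq_eq]

/-- The differential of the cost at `u` factors through that of the end-point mapping: up to
normalization, `u` has a Lagrange multiplier with nonzero cost component. -/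
def IsNormalControl (f₀ : State n → State n) (f : Fin m → State n → State n) (u : Control m T)
    (l : Covector n) : Prop :=
  ∀ w, l (dEndpoint f₀ f T u w) = ⟪u, w⟫

theorem IsAdjoint.add_smul {N : C(Icc (0 : ℝ) T, State n →L[ℝ] AugSpace m →L[ℝ] State n)}
    {v : Lp (AugSpace m) 2 (timeMeasure T)} {η η' : Covector n}
    {P P' : C(Icc (0 : ℝ) T, Covector n)} (h : IsAdjoint hT N v η P)
    (h' : IsAdjoint hT N v η' P') (c : ℝ) : IsAdjoint hT N v (η + c • η') (P + c • P') := by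
  set V := volterra hT (adjointFamily N) v with hV
  have h1 : V (P + c • P') = V P + c • V P' := by rw [V.map_add, V.map_smul]
  have h2 : P + c • P' = (ContinuousMap.const _ η + V P) + c • (ContinuousMap.const _ η' + V P') :=
    congrArg₂ (fun a b => a + c • b) h h'
  have h3 : ContinuousMap.const (Icc (0 : ℝ) T) (η + c • η') =
    ContinuousMap.const _ η + c • ContinuousMap.const _ η' := rfl
  unfold IsAdjoint
  rw [← hV, h1, h3, h2.trans (congrArg _ (smul_add c _ _))]
  exact add_add_add_comm _ _ _ _

theorem switching_add_smul (hf : ∀ i, Continuous (f i)) (X : C(Icc (0 : ℝ) T, State n))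
    (P P' : C(Icc (0 : ℝ) T, Covector n)) (c : ℝ) :
    switching hT hf X (P + c • P') = switching hT hf X P + c • switching hT hf X P' := by
  ext1
  filter_upwards [coeFn_switching (hT := hT) hf X (P + c • P'), coeFn_switching (hT := hT) hf X P,
    coeFn_switching (hT := hT) hf X P', Lp.coeFn_smul c (switching hT hf X P'),
    Lp.coeFn_add (switching hT hf X P) (c • switching hT hf X P')] with t h1 h2 h3 h4 h5
  rw [h1, h5, Pi.add_apply, h4, Pi.smul_apply, h2, h3]
  ext i
  simp [normalControl, IccExtend]

theorem contDiff_one_of_two (hf₀ : ContDiff ℝ 2 f₀) (hf : ∀ i, ContDiff ℝ 2 (f i)) :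
    ContDiff ℝ 1 f₀ ∧ ∀ i, ContDiff ℝ 1 (f i) :=
  ⟨hf₀.of_le (by norm_num), fun i => (hf i).of_le (by norm_num)⟩

theorem endpoint_eq_of_isAdjoint (hf₀ : ContDiff ℝ 2 f₀) (hf : ∀ i, ContDiff ℝ 2 (f i))
    {u : Control m T} {X : C(Icc (0 : ℝ) T, State n)}
    (h₀ : ContDiff ℝ 1 f₀) (h₁ : ∀ i, ContDiff ℝ 1 (f i))
    (h : IsSolution hT (contDiff_affineField h₀ h₁).continuous (augment u) X)
    {η : Covector n} {P : C(Icc (0 : ℝ) T, Covector n)}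
    (hP : IsAdjoint hT (derivAlong (contDiff_affineField h₀ h₁) X) (augment u) η P)
    (hu : u = switching hT (fun i => (h₁ i).continuous) X P) :
    ∃ hη : η ∈ normalDomain f₀ f T,
      expMap f₀ f T (fun i => (hf i).continuous) ⟨η, hη⟩ = endpoint f₀ f T u := by
  have hN := h.isNormalExtremal h₀ h₁ hP hu
  refine ⟨⟨_, _, hN⟩, ?_⟩
  conv_rhs => rw [hu]
  exact hN.expMap_eq hf₀ hf _

/-- If a normal control is also abnormal, then the fibre of the exponential mapping over its
end-point contains a line. -/
theorem not_isCompact_fibre (hf₀ : ContDiff ℝ 2 f₀) (hf : ∀ i, ContDiff ℝ 2 (f i))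
    (hT : 0 ≤ T) {u : Control m T} (hu : u ∈ admissible f₀ f T)
    {l q : Covector n} (hl : IsNormalControl f₀ f u l) (hq : q ≠ 0)
    (hq0 : ∀ w, q (dEndpoint f₀ f T u w) = 0) :
    ¬ IsCompact (expMap f₀ f T (fun i => (hf i).continuous) ⁻¹' {endpoint f₀ f T u}) := by
  obtain ⟨h₀, h₁⟩ := contDiff_one_of_two hf₀ hf
  obtain ⟨X, hX⟩ := exists_isSolution (hT := hT) (contDiff_affineField h₀ h₁).continuous hu
  obtain ⟨η, P, hP, -, hPs⟩ := hX.exists_adjoint h₀ h₁ l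
  obtain ⟨θ, Q, hQ, hQT, hQs⟩ := hX.exists_adjoint h₀ h₁ q
  have hus : u = switching hT (fun i => (h₁ i).continuous) X P :=
    ext_inner_right ℝ fun w => (hl w).symm.trans (hPs w)
  -- A covector annihilating `Im dE(u)` has zero switching function, so adding its transport leaves
  -- the control unchanged.
  have hs0 : switching hT (fun i => (h₁ i).continuous) X Q = 0 :=
    ext_inner_right ℝ fun w => by rw [← hQs w, hq0 w, inner_zero_left]
  have hθ : θ ≠ 0 := by
    rintro rfl
    have := hQ.norm_sq_le hT le_rfl ⟨T, hT, le_rfl⟩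
    rw [hQT] at this
    norm_num at this
    exact hq this
  intro hK
  have hb := (hK.image continuous_subtype_val).isBounded
  obtain ⟨R, hR⟩ := hb.exists_norm_le
  have hline (c : ℝ) : ‖η + c • θ‖ ≤ R := by
    obtain ⟨hη, he⟩ := endpoint_eq_of_isAdjoint hf₀ hf h₀ h₁ hX (hP.add_smul hQ c)
      (by rw [switching_add_smul, hs0, smul_zero, add_zero]; exact hus)
    exact hR _ ⟨⟨_, hη⟩, he, rfl⟩
  have hθ' := norm_pos_iff.2 hθ
  have h1 := hline ((R + ‖η‖ + 1) / ‖θ‖)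
  have h2 : R + ‖η‖ + 1 ≤ ‖((R + ‖η‖ + 1) / ‖θ‖) • θ‖ := by
    rw [norm_smul, norm_div, norm_norm, div_mul_cancel₀ _ hθ'.ne']
    exact Real.le_norm_self _
  have h3 := norm_le_add_norm_add ((((R + ‖η‖ + 1) / ‖θ‖) • θ)) η
  rw [add_comm _ η] at h3
  linarith

theorem tendsto_dEndpoint (hT : 0 ≤ T) {u : Control m T} (hu : u ∈ admissible f₀ f T)
    (h₀ : ContDiff ℝ 1 f₀) (h₁ : ∀ i, ContDiff ℝ 1 (f i)) :
    Tendsto (dEndpoint f₀ f T) (𝓝 u) (𝓝 (dEndpoint f₀ f T u)) := by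
  obtain ⟨X, hX⟩ := exists_isSolution (hT := hT) (contDiff_affineField h₀ h₁).continuous hu
  obtain ⟨φ, -, -, hφ⟩ := hX.exists_local h₀ h₁
  exact tendsto_fderiv_of_hasStrictFDerivAt (hX.hasStrictFDerivAt_endpoint h₀ h₁).1
    (hφ.mono fun w hw => (hw.hasStrictFDerivAt_endpoint h₀ h₁).1.hasFDerivAt)

/-- If the exponential mapping is proper, then limits of normal controls are normal. -/
theorem eventually_not_isNormalControl (hf₀ : ContDiff ℝ 2 f₀) (hf : ∀ i, ContDiff ℝ 2 (f i))
    (hT : 0 ≤ T) {u : Control m T}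
    (hu : u ∈ admissible f₀ f T)
    (hproper : ∀ K : Set (State n), IsCompact K →
      IsCompact (expMap f₀ f T (fun i => (hf i).continuous) ⁻¹' K))
    (hnot : ∀ l, ¬ IsNormalControl f₀ f u l) :
    ∀ᶠ v in 𝓝 u, ∀ l, ¬ IsNormalControl f₀ f v l := by
  obtain ⟨h₀, h₁⟩ := contDiff_one_of_two hf₀ hf
  by_contra hcon
  simp only [not_eventually, not_forall, not_not] at hcon
  obtain ⟨v, hv, hvl⟩ := exists_seq_forall_of_frequently hcon
  choose l hl using hvl
  obtain ⟨X, hX⟩ := exists_isSolution (hT := hT) (contDiff_affineField h₀ h₁).continuous hu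
  obtain ⟨φ, hφu, hφc, hφ⟩ := hX.exists_local h₀ h₁
  have hE := (hX.hasStrictFDerivAt_endpoint h₀ h₁).1.continuousAt
  -- Properness is used here: initial covectors whose end-point lies within distance 1 of `E(u)` are
  -- bounded by `R`.
  obtain ⟨R, hR⟩ := ((hproper _ (isCompact_closedBall (endpoint f₀ f T u) 1)).image
    continuous_subtype_val).isBounded.exists_norm_le
  have hcoef : Tendsto (fun k => ‖augment (v k)‖ *
      ‖derivAlong (contDiff_affineField h₀ h₁) (φ (v k))‖) atTop
      (𝓝 (‖augment u‖ * ‖derivAlong (contDiff_affineField h₀ h₁) (φ u)‖)) := by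
    have h1 : ContinuousAt (fun v => derivAlong (contDiff_affineField h₀ h₁) (φ v)) u :=
      (ContinuousMap.continuous_postcomp _).continuousAt.comp hφc
    exact ((continuous_augment.continuousAt.norm.mul h1.norm).tendsto).comp hv
  set B := ‖augment u‖ * ‖derivAlong (contDiff_affineField h₀ h₁) (φ u)‖ + 1 with hB
  -- Gronwall carries the bound from the initial covector to its final value `l k`, uniformly since
  -- the coefficients stay below `B`.
  have hbound : ∀ᶠ k in atTop, ‖l k‖ ^ 2 ≤
      2 * R ^ 2 + 2 * B ^ 2 * (Real.exp (2 * B ^ 2 * T) * (T * (2 * R ^ 2))) := by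
    filter_upwards [hv.eventually hφ, hcoef.eventually (eventually_le_nhds (lt_add_one _)),
      (hE.tendsto.comp hv).eventually (Metric.closedBall_mem_nhds _ one_pos)] with k hk hkB hkE
    obtain ⟨η, P, hP, hPT, hPs⟩ := hk.exists_adjoint h₀ h₁ (l k)
    have hs : v k = switching hT (fun i => (h₁ i).continuous) (φ (v k)) P :=
      ext_inner_right ℝ fun w => (hl k w).symm.trans (hPs w)
    obtain ⟨hη, he⟩ := endpoint_eq_of_isAdjoint hf₀ hf h₀ h₁ hk hP hs
    have hηR : ‖η‖ ≤ R := hR _ ⟨⟨η, hη⟩, by rw [mem_preimage, he]; exact hkE, rfl⟩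
    have := hP.norm_sq_le hT hkB ⟨T, hT, le_rfl⟩
    rw [hPT] at this
    refine this.trans ?_
    gcongr
  obtain ⟨k₀, hk₀⟩ := eventually_atTop.1 hbound
  have hbd : ∀ k, l (k + k₀) ∈ Metric.closedBall (0 : Covector n)
      √(2 * R ^ 2 + 2 * B ^ 2 * (Real.exp (2 * B ^ 2 * T) * (T * (2 * R ^ 2)))) := fun k =>
    mem_closedBall_zero_iff.2 (Real.le_sqrt_of_sq_le (hk₀ _ (by omega)))
  obtain ⟨p₀, -, σ, hσ, hlim⟩ :=
    (isCompact_closedBall (0 : Covector n) _).tendsto_subseq hbd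
  refine hnot p₀ fun w => ?_
  have hvσ : Tendsto (fun j => v (σ j + k₀)) atTop (𝓝 u) :=
    hv.comp ((tendsto_add_atTop_nat k₀).comp hσ.tendsto_atTop)
  have hd : Tendsto (fun j => dEndpoint f₀ f T (v (σ j + k₀))) atTop (𝓝 (dEndpoint f₀ f T u)) :=
    (tendsto_dEndpoint hT hu h₀ h₁).comp hvσ
  have hl' : Tendsto (fun j => l (σ j + k₀)) atTop (𝓝 p₀) := hlim
  have hdw := ((ContinuousLinearMap.apply ℝ (State n) w).continuous.tendsto _).comp hd
  have h1 := ((isBoundedBilinearMap_apply (𝕜 := ℝ) (E := State n) (F := ℝ)).continuous.tendsto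
    (p₀, dEndpoint f₀ f T u w)).comp (hl'.prodMk_nhds hdw)
  have h2 : Tendsto (fun j => ⟪v (σ j + k₀), w⟫) atTop (𝓝 ⟪u, w⟫) :=
    hvσ.inner tendsto_const_nhds
  refine tendsto_nhds_unique h1 (h2.congr fun j => ?_)
  exact (hl _ w).symm

theorem finrank_quotient_range_add_finrank_range (L : Control m T →L[ℝ] State n) :
    Module.finrank ℝ (State n ⧸ LinearMap.range L.toLinearMap) +
      Module.finrank ℝ (LinearMap.range L.toLinearMap) = n := by
  rw [Submodule.finrank_quotient_add_finrank, finrank_euclideanSpace_fin]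

/-- Near a control of corank one, abnormal controls have corank one. -/
theorem eventually_corank_eq_one (hT : 0 ≤ T) {u : Control m T} (hu : u ∈ admissible f₀ f T)
    (h₀ : ContDiff ℝ 1 f₀) (h₁ : ∀ i, ContDiff ℝ 1 (f i)) (hc : corank f₀ f T u = 1) :
    ∀ᶠ v in 𝓝 u, IsAbnormal f₀ f T v → corank f₀ f T v = 1 := by
  have hrank (L : Control m T →L[ℝ] State n) (k : ℕ) :
      (k : Cardinal) ≤ (L : Control m T →ₗ[ℝ] State n).rank ↔
        k ≤ Module.finrank ℝ (LinearMap.range L.toLinearMap) := by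
    rw [LinearMap.rank, ← Module.finrank_eq_rank, Nat.cast_le]
  -- Rank at least `n - 1` is an open condition. Corank 1 forces `n ≥ 1`, so the subtraction is not
  -- truncated.
  have hopen := (isOpen_setOfPred_nat_le_rank (𝕜 := ℝ) (E := Control m T) (F := State n)
    (n - 1)).mem_nhds (x := dEndpoint f₀ f T u) ((hrank _ _).2 (by
      have := finrank_quotient_range_add_finrank_range (dEndpoint f₀ f T u)
      unfold corank at hc
      omega))
  filter_upwards [tendsto_dEndpoint hT hu h₀ h₁ hopen] with v hv hab
  have h1 := (hrank _ _).1 hv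
  have h2 := finrank_quotient_range_add_finrank_range (dEndpoint f₀ f T v)
  have h3 := finrank_quotient_range_add_finrank_range (dEndpoint f₀ f T u)
  have h4 : Module.finrank ℝ (LinearMap.range (dEndpoint f₀ f T v).toLinearMap) ≠ n := fun h => by
    refine hab (LinearMap.range_eq_top.1 (Submodule.eq_top_of_finrank_eq (h.trans ?_)))
    simp
  unfold corank at *
  omega

/-- A minimizing control that is not abnormal is normal. -/
theorem IsMinimizing.exists_isNormalControl (hT : 0 ≤ T) {u : Control m T}
    (hu : IsMinimizing f₀ f T u) (h₀ : ContDiff ℝ 1 f₀) (h₁ : ∀ i, ContDiff ℝ 1 (f i))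
    (hab : ¬ IsAbnormal f₀ f T u) : ∃ l, IsNormalControl f₀ f u l := by
  obtain ⟨X, hX⟩ := exists_isSolution (hT := hT) (contDiff_affineField h₀ h₁).continuous hu.1
  obtain ⟨φ, -, -, hφ⟩ := hX.exists_local h₀ h₁
  have hE := (hX.hasStrictFDerivAt_endpoint h₀ h₁).1
  have hN : HasStrictFDerivAt (fun v : Control m T => ‖v‖ ^ 2) (2 • innerSL ℝ u) u :=
    hasStrictFDerivAt_norm_sq u
  have hmin : IsLocalMinOn (fun v : Control m T => ‖v‖ ^ 2)
      {v | endpoint f₀ f T v = endpoint f₀ f T u} u := by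
    -- Minimality compares admissible controls only, and `endpoint` has a default value elsewhere;
    -- near `u` every control is admissible.
    filter_upwards [mem_nhdsWithin_of_mem_nhds hφ, self_mem_nhdsWithin] with v hv hvE
    have := hu.2 v hv.mem_admissible hvE
    rwa [cost_eq_norm_sq hT, cost_eq_norm_sq hT] at this
  obtain ⟨Λ, Λ₀, hne, hΛ⟩ :=
    IsLocalExtrOn.exists_linear_map_of_hasStrictFDerivAt (Or.inl hmin) hE hN
  have hsurj : Function.Surjective (dEndpoint f₀ f T u) := not_not.1 hab
  have hΛ₀ : Λ₀ ≠ 0 := by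
    rintro rfl
    refine hne (Prod.ext (LinearMap.ext fun z => ?_) rfl)
    obtain ⟨w, rfl⟩ := hsurj z
    simpa using hΛ w
  -- The factor 2 comes from the differential `2⟪u, ·⟫` of the squared norm.
  refine ⟨-(2 * Λ₀)⁻¹ • LinearMap.toContinuousLinearMap Λ, fun w => ?_⟩
  have h1 := hΛ w
  simp only [smul_eq_mul, two_smul, add_apply, innerSL_apply_apply] at h1
  rw [smul_apply, LinearMap.coe_toContinuousLinearMap', smul_eq_mul, eq_neg_of_add_eq_zero_left h1]
  field_simp
  ring

/-- The end-point mapping is weakly sequentially continuous near an admissible control. -/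
theorem exists_weakTendsto_endpoint (hT : 0 ≤ T) {u : Control m T}
    (hu : u ∈ admissible f₀ f T) (h₀ : ContDiff ℝ 1 f₀) (h₁ : ∀ i, ContDiff ℝ 1 (f i)) :
    ∃ s ∈ 𝓝 u, ∀ (w : ℕ → Control m T), (∀ j, w j ∈ s) → ∀ v ∈ s, WeakTendsto w v →
      Tendsto (fun j => endpoint f₀ f T (w j)) atTop (𝓝 (endpoint f₀ f T v)) := by
  obtain ⟨X, hX⟩ := exists_isSolution (hT := hT) (contDiff_affineField h₀ h₁).continuous hu
  obtain ⟨φ, hφu, hφc, hφ⟩ := hX.exists_local h₀ h₁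
  -- Weak convergence of controls passes to trajectories only under uniform bounds, obtained here by
  -- shrinking the neighborhood.
  have hbd : ∀ᶠ v in 𝓝 u, ‖φ v‖ ≤ ‖φ u‖ + 1 :=
    hφc.norm.eventually (eventually_le_nhds (lt_add_one _))
  have hbd' : ∀ᶠ v in 𝓝 u, ‖augment v‖ ≤ ‖augment u‖ + 1 :=
    continuous_augment.continuousAt.norm.eventually (eventually_le_nhds (lt_add_one _))
  refine ⟨_, hφ.and (hbd.and hbd'), fun w hw v hv hweak => ?_⟩
  have h2 := hv.1.tendsto_of_weak hT (contDiff_affineField h₀ h₁) (fun j => (hw j).1)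
    (fun j => (hw j).2.2) (fun j => (hw j).2.1) (fun ℓ => ?_) ⟨T, hT, le_rfl⟩
  · rw [hv.1.endpoint_eq h₀ h₁]
    exact h2.congr fun j => ((hw j).1.endpoint_eq h₀ h₁).symm
  · simp only [augment, map_add]
    exact (hweak (ℓ ∘L augmentL m T)).const_add _

theorem not_proper_expMap (hf₀ : ContDiff ℝ 2 f₀) (hf : ∀ i, ContDiff ℝ 2 (f i))
    (hT : 0 ≤ T) {A : State n}
    (hA : ∃! u : Control m T, IsMinimizing f₀ f T u ∧ endpoint f₀ f T u = A ∧
        IsAbnormal f₀ f T u ∧ corank f₀ f T u = 1) :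
    ¬ ∀ K : Set (State n), IsCompact K →
      IsCompact (expMap f₀ f T (fun i => (hf i).continuous) ⁻¹' K) := by
  intro hproper
  obtain ⟨h₀, h₁⟩ := contDiff_one_of_two hf₀ hf
  obtain ⟨u, ⟨hmin, rfl, hab, hc⟩, huniq⟩ := hA
  have hu := hmin.1
  have hnot : ∀ l, ¬ IsNormalControl f₀ f u l := fun l hl => by
    obtain ⟨q, hq, hq0⟩ := Submodule.exists_le_ker_of_lt_top
      (LinearMap.range (dEndpoint f₀ f T u).toLinearMap)
      (lt_top_iff_ne_top.2 fun h => hab (LinearMap.range_eq_top.1 h))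
    refine not_isCompact_fibre hf₀ hf hT hu hl (q := LinearMap.toContinuousLinearMap q)
      (fun h => hq ?_) (fun w => ?_) (hproper _ isCompact_singleton)
    · ext z
      exact DFunLike.congr_fun h z
    · exact hq0 ⟨w, rfl⟩
  obtain ⟨s, hs, hweak⟩ := exists_weakTendsto_endpoint hT hu h₀ h₁
  obtain ⟨X, hX⟩ := exists_isSolution (hT := hT) (contDiff_affineField h₀ h₁).continuous hu
  obtain ⟨φ, -, -, hφ⟩ := hX.exists_local h₀ h₁
  have hall := ((eventually_not_isNormalControl hf₀ hf hT hu hproper hnot).and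
    (eventually_corank_eq_one hT hu h₀ h₁ hc)).and (hφ.and (Filter.eventually_mem_set.2 hs))
  obtain ⟨δ, hδ, hball⟩ := Metric.nhds_basis_closedBall.mem_iff.1 hall
  -- Finiteness of the exponent gives separability of L², needed to extract weakly convergent
  -- subsequences.
  have : Fact ((2 : ENNReal) ≠ ⊤) := ⟨by norm_num⟩
  obtain ⟨v, hv, hvmin⟩ := exists_tendsto_isMinOn_penalized (F := endpoint f₀ f T) (u := u) hδ.le
    (fun w v hw hwv => hweak w (fun j => (hball (hw j)).2.2) v
      (hball (hwv.mem_closedBall hw)).2.2 hwv)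
    (fun v hv hvE hvn => by
      obtain ⟨⟨hvn', hvc⟩, hvφ, -⟩ := hball hv
      -- A control in the same fibre costing no more than `u` is itself minimizing, so the
      -- abnormal/normal dichotomy applies to it.
      have hvmin : IsMinimizing f₀ f T v := by
        refine ⟨hvφ.mem_admissible, fun w hw hwE => ?_⟩
        refine le_trans ?_ (hmin.2 w hw (hwE.trans hvE))
        rw [cost_eq_norm_sq hT, cost_eq_norm_sq hT]
        gcongr
      by_cases hvab : IsAbnormal f₀ f T v
      · exact huniq v ⟨hvmin, hvE, hvab, hvc hvab⟩
      · obtain ⟨l, hl⟩ := hvmin.exists_isNormalControl hT h₀ h₁ hvab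
        exact absurd hl (hvn' l))
  -- One `k` with minimizer in the open ball suffices: there the constraint is inactive.
  obtain ⟨k, hk⟩ := (hv.eventually (Metric.ball_mem_nhds u hδ)).exists
  have hloc : IsLocalMin (penalized (endpoint f₀ f T) (endpoint f₀ f T u) k) (v k) :=
    (hvmin k).isLocalMin (mem_of_superset (Metric.isOpen_ball.mem_nhds hk)
      Metric.ball_subset_closedBall)
  obtain ⟨⟨hvn, -⟩, hvφ, -⟩ := hball (Metric.ball_subset_closedBall hk)
  obtain ⟨l, hl⟩ := exists_multiplier_of_isLocalMin_penalized hloc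
    (hvφ.hasStrictFDerivAt_endpoint h₀ h₁).1.hasFDerivAt
  exact hvn l hl

end Main

end AffineControl

end

theorem mainTheorem6 {n m : ℕ}
    (f₀ : AffineControl.State n → AffineControl.State n)
    (f : Fin m → AffineControl.State n → AffineControl.State n)
    (hf₀ : AnalyticOnNhd ℝ f₀ Set.univ) (hf : ∀ i, AnalyticOnNhd ℝ (f i) Set.univ)
    (T : ℝ) (hT : 0 < T) (r : ℝ) (hr : 0 < r) (A : AffineControl.State n)
    (hA : ∃! u : AffineControl.Control m T,
      AffineControl.IsMinimizing f₀ f T u ∧ AffineControl.endpoint f₀ f T u = A ∧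
        AffineControl.IsAbnormal f₀ f T u ∧ AffineControl.corank f₀ f T u = 1)
    (hH : ∀ V ∈ 𝓝 A, ∃ P ∈ V ∩ AffineControl.sublevel f₀ f T r,
      AffineControl.IsNormalPoint f₀ f T P) :
    ¬ ∀ K : Set (AffineControl.State n), IsCompact K →
      IsCompact (AffineControl.expMap f₀ f T (fun i => (hf i).continuous) ⁻¹' K) :=
  AffineControl.not_proper_expMap hf₀.contDiff (fun i => (hf i).contDiff) hT.le hA
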